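/- **Setting.** Let $\mathbb H$ be the quaternions, $\mathbb S_{\mathbb H}=\{J\in\mathbb H: J^2=-1\}$, $n\ge 1$, and for $K=\{k_1<\dots<k_p\}\subseteq\{1,\dots,n\}$ and $q_1,\dots,q_n\in\mathbb H$ put $q_K:=q_{k_1}\cdots q_{k_p}$ (ordered product), $q_\emptyset:=1$. Let $D\subseteq\mathbb C^n$ be open and invariant under $z\mapsto\overline z^{h}$ (complex conjugation of the $h$-th coordinate) for every $h$, and let $\Omega_D\subseteq\mathbb H^n$ be the set of the points $(\alpha_1+J_1\beta_1,\dots,\alpha_n+J_n\beta_n)$ with $(\alpha_1+i\beta_1,\dots,\alpha_n+i\beta_n)\in D$ and $J_1,\dots,J_n\in\mathbb S_{\mathbb H}$. A stem function on $D$ is a map $F=\sum_{K\subseteq\{1,\dots,n\}}e_KF_K:D\to\mathbb H\otimes\mathbb R^{2^n}$ with $F_K(\overline z^{h})=(-1)^{|K\cap\{h\}|}F_K(z)$ for all $K$ and $h$. It induces the (well defined) slice function $f=\mathcal I(F):\Omega_D\to\mathbb H$, $f(\alpha_1+J_1\beta_1,\dots,\alpha_n+J_n\beta_n)=\sum_K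 J_K\,F_K(\alpha_1+i\beta_1,\dots,\alpha_n+i\beta_n)$, and $f$ determines $F$. The function $f$ is slice regular if $F$ is of class $C^1$ and, for every $h$, $\frac{\partial F}{\partial\alpha_h}+\mathcal J_h\frac{\partial F}{\partial\beta_h}=0$, where $\mathcal J_h(q\otimes e_K)=(-1)^{|K\cap\{h\}|}q\otimes e_{K\triangle\{h\}}$. The spherical derivative of $f=\mathcal I(F)$ with respect to $x_h$ is $f'_{s,h}:=\mathcal I(F'_h)$, $F'_h(z)=\sum_{K\not\ni h}e_K\,\beta_h^{-1}F_{K\cup\{h\}}(z)$, where for $\beta_h=0$ the quotient is replaced by its limit $\frac{\partial F_{K\cup\{h\}}}{\partial\beta_h}(z)$. Put $\mathcal S^0_\emptyset(f):=f$ and $\mathcal S^j_\emptyset(f):=(\cdots(f'_{s,1})'_{s,2}\cdots)'_{s,j}$ for $j=1,\dots,n$. Let $\sigma=\mathcal H^3/\mathcal H^3(\mathbb S^3)$ be the normalized surface measure of the unit sphere $\mathbb S^3\subset\mathbb H\cong\mathbb R^4$, and $\sigma^k$ its $k$-th power on $(\mathbb S^3)^k$. For $a\in\mathbb H^n$ the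 symbol $a+\sum_{i=1}^k r_i\lambda_i$ denotes the point with $i$-th coordinate $a_i+r_i\lambda_i$ if $i\le k$, and $a_i$ if $i>k$. **Proposition 4.11 (Second mean value formula).** Let $f$ be slice regular on $\Omega_D$, let $a=(a_1,\dots,a_n)\in\Omega_D$, and let $r_1,\dots,r_n\ge 0$ be such that $\overline B_{r_1}(a_1)\times\dots\times\overline B_{r_n}(a_n)\subseteq\Omega_D$, where $\overline B_r(b)=\{x\in\mathbb H:|x-b|\le r\}$. Then for every $m=1,\dots,n$ all the integrands below are integrable, and $$ \begin{aligned} f(a)={}&\sum_{j=0}^{m-1}r_{\{1,\dots,j\}}\int_{(\mathbb S^3)^{j+1}}\overline\lambda_{\{1,\dots,j\}}\;\mathcal S^j_\emptyset(f)\Big(a+\sum_{i=1}^{j+1}r_i\lambda_i\Big)\,d\sigma^{j+1}(\lambda)\\ &+r_{\{1,\dots,m\}}\int_{(\mathbb S^3)^{m}}\overline\lambda_{\{1,\dots,m\}}\;\mathcal S^m_\emptyset(f)\Big(a+\sum_{i=1}^{m}r_i\lambda_i\Big)\,d\sigma^{m}(\lambda), \end{aligned} $$ where $r_{\{1,\dots,j\}}=r_1\cdots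 r_j$, $\overline\lambda_{\{1,\dots,j\}}=\overline\lambda_1\cdots\overline\lambda_j$ and $r_\emptyset=\overline\lambda_\emptyset=1$. -/

import Mathlib

open scoped Quaternion

namespace SliceSeveral

noncomputable section

/-! ### Stem functions

The variables are indexed by `Fin n`.  A function `F = ∑ K, e_K F_K` with values in
`ℍ ⊗ ℝ^(2^n)` is encoded by its components: `F z K` is `F_K(z)`. -/

/-- The space `ℍ ⊗ ℝ^(2^n)`, an element being given by its `e_K`-components. -/
abbrev StemSpace (n : ℕ) : Type := Finset (Fin n) → ℍ

/-- The ordered product `q_K = q_{k₁} ⋯ q_{k_p}`, `K = {k₁ < ⋯ < k_p}` (and `q_∅ = 1`). -/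
def orderedProd {n : ℕ} (q : Fin n → ℍ) (K : Finset (Fin n)) : ℍ :=
  (K.sort.map q).prod

/-- The set of the first `j` of `k` indices, i.e. `{1, …, j} ⊆ {1, …, k}`. -/
def firstVars (k j : ℕ) : Finset (Fin k) :=
  Finset.univ.filter fun i => i.val < j

/-- `𝕊_ℍ`, the square roots of `-1`. -/
def imagUnits : Set ℍ := {J | J ^ 2 = -1}

/-- Complex conjugation of the `h`-th coordinate. -/
def conjAt {n : ℕ} (h : Fin n) (z : Fin n → ℂ) : Fin n → ℂ :=
  Function.update z h (star (z h))

/-- `F` is a stem function on `D` (in particular `D` is invariant under the conjugations). -/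
def IsStem {n : ℕ} (D : Set (Fin n → ℂ)) (F : (Fin n → ℂ) → StemSpace n) : Prop :=
  (∀ z ∈ D, ∀ h, conjAt h z ∈ D) ∧
    ∀ z ∈ D, ∀ h K, F (conjAt h z) K = (-1 : ℝ) ^ (K ∩ {h}).card • F z K

/-- The point `(α₁ + J₁ β₁, …, αₙ + Jₙ βₙ)`, where `z_h = α_h + i β_h`. -/
def slicePoint {n : ℕ} (z : Fin n → ℂ) (J : Fin n → ℍ) : Fin n → ℍ :=
  fun h => ((z h).re : ℍ) + J h * ((z h).im : ℍ)

/-- The circularization `Ω_D` of `D`. -/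
def circularization {n : ℕ} (D : Set (Fin n → ℂ)) : Set (Fin n → ℍ) :=
  {x | ∃ z ∈ D, ∃ J : Fin n → ℍ, (∀ h, J h ∈ imagUnits) ∧ x = slicePoint z J}

/-- A choice of `z` with `x_h = Re z_h + J_h Im z_h`: the one with `Im z_h ≥ 0`. -/
def complexCoord {n : ℕ} (x : Fin n → ℍ) : Fin n → ℂ :=
  fun h => ⟨(x h).re, ‖(x h).im‖⟩

/-- The quaternion unit `i`. -/
def quatI : ℍ := ⟨0, 1, 0, 0⟩

open Classical in
/-- The corresponding imaginary units (with an irrelevant choice for real coordinates). -/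
def unitCoord {n : ℕ} (x : Fin n → ℍ) : Fin n → ℍ :=
  fun h => if (x h).im = 0 then quatI else ‖(x h).im‖⁻¹ • (x h).im

/-- The function `𝓘(F)` induced by `F`.  For a stem function it does not depend on the choice of
the representation `x = (α_h + J_h β_h)_h`, see `induced_slicePoint`. -/
def induced {n : ℕ} (F : (Fin n → ℂ) → StemSpace n) (x : Fin n → ℍ) : ℍ :=
  ∑ K : Finset (Fin n), orderedProd (unitCoord x) K * F (complexCoord x) K

/-- `f` is a slice function on `Ω_D`. -/
def IsSlice {n : ℕ} (D : Set (Fin n → ℂ)) (f : (Fin n → ℍ) → ℍ) : Prop :=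
  ∃ F, IsStem D F ∧ Set.EqOn f (induced F) (circularization D)

/-! ### Slice regularity -/

/-- The complex structure `𝓙_h`: `𝓙_h (q ⊗ e_K) = (-1)^|K ∩ {h}| q ⊗ e_{K Δ {h}}`. -/
def complexStructure {n : ℕ} (h : Fin n) (q : StemSpace n) : StemSpace n :=
  ∑ K : Finset (Fin n), Pi.single (symmDiff K {h}) ((-1 : ℝ) ^ (K ∩ {h}).card • q K)

/-- `∂/∂α_h`. -/
def partialAlpha {n : ℕ} (h : Fin n) (F : (Fin n → ℂ) → StemSpace n) (z : Fin n → ℂ) :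
    StemSpace n :=
  lineDeriv ℝ F z (Pi.single h 1)

/-- `∂/∂β_h`. -/
def partialBeta {n : ℕ} (h : Fin n) (F : (Fin n → ℂ) → StemSpace n) (z : Fin n → ℂ) :
    StemSpace n :=
  lineDeriv ℝ F z (Pi.single h Complex.I)

/-- The operator `∂̄_h = (∂/∂α_h + 𝓙_h ∂/∂β_h) / 2`. -/
def dbar {n : ℕ} (h : Fin n) (F : (Fin n → ℂ) → StemSpace n) (z : Fin n → ℂ) : StemSpace n :=
  (1 / 2 : ℝ) • (partialAlpha h F z + complexStructure h (partialBeta h F z))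

/-- `F` is of class `C¹` and `h`-holomorphic for every `h`. -/
def IsHolomorphicStem {n : ℕ} (D : Set (Fin n → ℂ)) (F : (Fin n → ℂ) → StemSpace n) : Prop :=
  ContDiffOn ℝ 1 F D ∧ ∀ h, ∀ z ∈ D, dbar h F z = 0

/-- `f` is slice regular on `Ω_D`: it is induced by a holomorphic stem function. -/
def IsSliceRegular {n : ℕ} (D : Set (Fin n → ℂ)) (f : (Fin n → ℍ) → ℍ) : Prop :=
  ∃ F, IsStem D F ∧ IsHolomorphicStem D F ∧ Set.EqOn f (induced F) (circularization D)

/-! ### Products of stem functions and spherical derivatives -/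

/-- The product `F ⊗ G` of stem functions. -/
def stemMul {n : ℕ} (F G : (Fin n → ℂ) → StemSpace n) : (Fin n → ℂ) → StemSpace n :=
  fun z => ∑ K : Finset (Fin n), ∑ H : Finset (Fin n),
    Pi.single (symmDiff K H) ((-1 : ℝ) ^ (H ∩ K).card • (F z K * G z H))

/-- The constant stem function `1`. -/
def stemOne {n : ℕ} : (Fin n → ℂ) → StemSpace n :=
  fun _ => Pi.single ∅ 1

/-- The stem function `Z_j = α_j + e_j β_j`, which induces the monomial `x_j`. -/
def stemVar {n : ℕ} (j : Fin n) : (Fin n → ℂ) → StemSpace n :=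
  fun z => Pi.single ∅ ((z j).re : ℍ) + Pi.single {j} ((z j).im : ℍ)

/-- The product `Z_K = Z_{k₁} ⊗ ⋯ ⊗ Z_{k_p}`, which induces `x_K`. -/
def stemMonomial {n : ℕ} (K : Finset (Fin n)) : (Fin n → ℂ) → StemSpace n :=
  (K.sort.map stemVar).foldr stemMul stemOne

/-- The stem function `F'_h = ∑_{K ∌ h} e_K β_h⁻¹ F_{K ∪ {h}}` of the spherical derivative.
`F_{K ∪ {h}}` vanishes where `β_h = 0`; there the quotient takes its limit value
`∂F_{K ∪ {h}}/∂β_h`, which is the continuous extension when `F` is of class `C¹`. -/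
def sphDeriv {n : ℕ} (h : Fin n) (F : (Fin n → ℂ) → StemSpace n) : (Fin n → ℂ) → StemSpace n :=
  fun z K =>
    if h ∈ K then 0
    else if (z h).im = 0 then partialBeta h F z (insert h K)
    else (z h).im⁻¹ • F z (insert h K)

/-- The iterated spherical derivative `F'_H = (⋯(F'_{h₁})'_{h₂}⋯)'_{h_p}`, `H = {h₁ < ⋯ < h_p}`. -/
def iterSphDeriv {n : ℕ} (H : Finset (Fin n)) (F : (Fin n → ℂ) → StemSpace n) :
    (Fin n → ℂ) → StemSpace n :=
  H.sort.foldl (fun G h => sphDeriv h G) F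

/-- `G^H_K(F) = (Z_K ⊗ F)'_H`. -/
def stemComponent {n : ℕ} (H K : Finset (Fin n)) (F : (Fin n → ℂ) → StemSpace n) :
    (Fin n → ℂ) → StemSpace n :=
  iterSphDeriv H (stemMul (stemMonomial K) F)

open Classical in
/-- `𝓘⁻¹(f)`, the stem function that induces the slice function `f` on `Ω_D`.
It is unique on `D`, see `stem_unique`. -/
def stemOf {n : ℕ} (D : Set (Fin n → ℂ)) (f : (Fin n → ℍ) → ℍ) : (Fin n → ℂ) → StemSpace n :=
  if hf : IsSlice D f then hf.choose else 0

/-- The component `𝓢^H_K(f) = (x_K ⊙ f)'_{s,H}` of a slice function `f` on `Ω_D`. -/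
def component {n : ℕ} (D : Set (Fin n → ℂ)) (H K : Finset (Fin n)) (f : (Fin n → ℍ) → ℍ) :
    (Fin n → ℍ) → ℍ :=
  induced (stemComponent H K (stemOf D f))

/-! ### Integration over products of spheres -/

instance instMeasurableSpaceQuaternion : MeasurableSpace ℍ := borel ℍ

instance instBorelSpaceQuaternion : BorelSpace ℍ := ⟨rfl⟩

/-- The unit sphere `𝕊³` of `ℍ = ℝ⁴`. -/
abbrev Sphere3 : Type := Metric.sphere (0 : ℍ) 1

/-- `σ = 𝓗³ / 𝓗³(𝕊³)`, the normalized surface measure of `𝕊³`. -/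
def sigma : MeasureTheory.Measure Sphere3 :=
  (MeasureTheory.Measure.hausdorffMeasure 3 (Set.univ : Set Sphere3))⁻¹ •
    MeasureTheory.Measure.hausdorffMeasure 3

/-- The power `σ^k` on `(𝕊³)^k`. -/
def sigmaPow (k : ℕ) : MeasureTheory.Measure (Fin k → Sphere3) :=
  MeasureTheory.Measure.pi fun _ => sigma

/-- The point `a + ∑_{i ≤ k} r_i λ_i`, where `r_i λ_i` is added to the `i`-th coordinate of `a`. -/
def shift {n k : ℕ} (a : Fin n → ℍ) (r : Fin n → ℝ) (lam : Fin k → Sphere3) : Fin n → ℍ :=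
  fun i => a i + if hi : i.val < k then r i • (lam ⟨i.val, hi⟩ : ℍ) else 0

/-- The ordered product `λ̄_{1,…,j} = λ̄_1 ⋯ λ̄_j`. -/
def conjProd {k : ℕ} (j : ℕ) (lam : Fin k → Sphere3) : ℍ :=
  orderedProd (fun i => star (lam i : ℍ)) (firstVars k j)

/-! ### The definitions are well posed -/

lemma re_eq_zero_of_mem_imagUnits {J : ℍ} (hJ : J ∈ imagUnits) : J.re = 0 ∧ ‖J‖ = 1 := by
  have hJ' : J ^ 2 = -1 := hJ
  have hn : ‖J‖ = 1 := by
    have h1 : ‖J‖ ^ 2 = 1 := by rw [← norm_pow, hJ', norm_neg, norm_one]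
    nlinarith [norm_nonneg J]
  refine ⟨?_, hn⟩
  have h2 : Quaternion.normSq J = 1 := by rw [Quaternion.normSq_eq_norm_mul_self, hn]; norm_num
  have h3 : J ^ 2 = -((Quaternion.normSq J : ℝ) : ℍ) := by rw [hJ', h2]; rfl
  exact Quaternion.sq_eq_neg_normSq.mp h3

lemma orderedProd_smul {n : ℕ} (ε : Fin n → ℝ) (J J' : Fin n → ℍ) (K : Finset (Fin n))
    (h : ∀ i ∈ K, J' i = ε i • J i) :
    orderedProd J' K = (∏ i ∈ K, ε i) • orderedProd J K := by
  have key : ∀ l : List (Fin n), (∀ i ∈ l, J' i = ε i • J i) →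
      (l.map J').prod = (l.map ε).prod • (l.map J).prod := by
    intro l
    induction l with
    | nil => simp
    | cons a t ih =>
      intro hl
      simp only [List.map_cons, List.prod_cons]
      rw [hl a (by simp), ih (fun i hi => hl i (by simp [hi])), smul_mul_smul_comm]
  have hprod : (K.sort.map ε).prod = ∏ i ∈ K, ε i := by
    rw [← List.prod_toFinset _ (Finset.sort_nodup K _), Finset.sort_toFinset]
  rw [orderedProd, orderedProd, key _ (by simpa using h), hprod]

lemma IsStem.conj_finset {n : ℕ} {D : Set (Fin n → ℂ)} {F : (Fin n → ℂ) → StemSpace n}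
    (hF : IsStem D F) (z : Fin n → ℂ) (hz : z ∈ D) (N : Finset (Fin n)) :
    (fun h => if h ∈ N then star (z h) else z h) ∈ D ∧
      ∀ K, F (fun h => if h ∈ N then star (z h) else z h) K =
        (∏ i ∈ K, if i ∈ N then (-1 : ℝ) else 1) • F z K := by
  induction N using Finset.induction_on with
  | empty => simpa using hz
  | insert a N ha ih =>
    have e : (fun h => if h ∈ insert a N then star (z h) else z h) =
        conjAt a (fun h => if h ∈ N then star (z h) else z h) := by
      funext h
      by_cases hh : h = a
      · subst hh; simp [conjAt, ha]
      · simp [conjAt, hh]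
    rw [e]
    refine ⟨hF.1 _ ih.1 a, fun K => ?_⟩
    rw [hF.2 _ ih.1, ih.2, smul_smul]
    congr 1
    have e2 : ((-1 : ℝ)) ^ (K ∩ {a}).card = ∏ i ∈ K, if i = a then (-1 : ℝ) else 1 := by
      rw [Finset.prod_ite, Finset.prod_const, Finset.prod_const_one, mul_one]
      congr 2
      ext i; simp
    rw [e2, ← Finset.prod_mul_distrib]
    refine Finset.prod_congr rfl fun i _ => ?_
    by_cases hi : i = a
    · subst hi; simp [ha]
    · simp [hi]

lemma IsStem.eq_zero {n : ℕ} {D : Set (Fin n → ℂ)} {F : (Fin n → ℂ) → StemSpace n}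
    (hF : IsStem D F) {z : Fin n → ℂ} (hz : z ∈ D) {h : Fin n} {K : Finset (Fin n)}
    (hK : h ∈ K) (him : (z h).im = 0) : F z K = 0 := by
  have e : conjAt h z = z := by
    have : star (z h) = z h := by apply Complex.ext <;> simp [him]
    rw [conjAt, this, Function.update_eq_self]
  have h1 := hF.2 z hz h K
  rw [e, Finset.inter_singleton_of_mem hK, Finset.card_singleton, pow_one, neg_one_smul] at h1
  have h2 : (2 : ℝ) • F z K = 0 := by
    rw [two_smul]
    nth_rewrite 1 [h1]
    exact neg_add_cancel _
  exact (smul_eq_zero.mp h2).resolve_left two_ne_zero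

lemma slicePoint_re {n : ℕ} (z : Fin n → ℂ) (J : Fin n → ℍ) (hJ : ∀ h, J h ∈ imagUnits)
    (h : Fin n) : (slicePoint z J h).re = (z h).re := by
  simp [slicePoint, (re_eq_zero_of_mem_imagUnits (hJ h)).1]

lemma slicePoint_im {n : ℕ} (z : Fin n → ℂ) (J : Fin n → ℍ) (hJ : ∀ h, J h ∈ imagUnits)
    (h : Fin n) : (slicePoint z J h).im = (z h).im • J h := by
  have := (re_eq_zero_of_mem_imagUnits (hJ h)).1
  ext <;> simp [slicePoint, this, mul_comm]

lemma complexCoord_slicePoint {n : ℕ} (z : Fin n → ℂ) (J : Fin n → ℍ)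
    (hJ : ∀ h, J h ∈ imagUnits) :
    complexCoord (slicePoint z J) = fun h =>
      if h ∈ (Finset.univ.filter fun i => (z i).im < 0) then star (z h) else z h := by
  funext h
  have e : ‖(slicePoint z J h).im‖ = |(z h).im| := by
    rw [slicePoint_im z J hJ, norm_smul, (re_eq_zero_of_mem_imagUnits (hJ h)).2]; simp
  rw [complexCoord, e, slicePoint_re z J hJ]
  by_cases hh : (z h).im < 0
  · simp only [Finset.mem_filter, Finset.mem_univ, true_and, hh, if_true]
    apply Complex.ext <;> simp [abs_of_neg hh]
  · simp only [Finset.mem_filter, Finset.mem_univ, true_and, hh, if_false]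
    apply Complex.ext <;> simp [abs_of_nonneg (not_lt.mp hh)]

lemma IsStem.complexCoord_mem {n : ℕ} {D : Set (Fin n → ℂ)} {F : (Fin n → ℂ) → StemSpace n}
    (hF : IsStem D F) {x : Fin n → ℍ} (hx : x ∈ circularization D) : complexCoord x ∈ D := by
  obtain ⟨z, hz, J, hJ, rfl⟩ := hx
  rw [complexCoord_slicePoint z J hJ]
  exact (hF.conj_finset z hz _).1

/-- The function induced by a stem function is given by the defining formula, whatever the
representation of the point. -/
lemma induced_slicePoint {n : ℕ} {D : Set (Fin n → ℂ)} {F : (Fin n → ℂ) → StemSpace n}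
    (hF : IsStem D F) {z : Fin n → ℂ} (hz : z ∈ D) {J : Fin n → ℍ}
    (hJ : ∀ h, J h ∈ imagUnits) :
    induced F (slicePoint z J) = ∑ K : Finset (Fin n), orderedProd J K * F z K := by
  unfold induced
  refine Finset.sum_congr rfl fun K _ => ?_
  rw [complexCoord_slicePoint z J hJ, (hF.conj_finset z hz _).2]
  by_cases hK : ∃ h ∈ K, (z h).im = 0
  · obtain ⟨h, hh, h0⟩ := hK
    simp [hF.eq_zero hz hh h0]
  · push Not at hK
    rw [orderedProd_smul
      (fun i => if i ∈ (Finset.univ.filter fun i => (z i).im < 0) then (-1 : ℝ) else 1) J]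
    · rw [smul_mul_smul_comm, ← Finset.prod_mul_distrib]
      rw [Finset.prod_eq_one, one_smul]
      intro i _
      split_ifs <;> norm_num
    · intro i hi
      have hJn := (re_eq_zero_of_mem_imagUnits (hJ i)).2
      have hJ0 : J i ≠ 0 := by
        intro h0
        rw [h0, norm_zero] at hJn
        exact zero_ne_one hJn
      have hne : (slicePoint z J i).im ≠ 0 := by
        rw [slicePoint_im z J hJ]
        exact smul_ne_zero (hK i hi) hJ0
      rw [unitCoord, if_neg hne, slicePoint_im z J hJ, norm_smul, hJn, mul_one, smul_smul]
      congr 1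
      by_cases hneg : (z i).im < 0
      · simp only [Finset.mem_filter, Finset.mem_univ, true_and, hneg, if_true]
        rw [Real.norm_eq_abs, abs_of_neg hneg]
        have := hK i hi
        field_simp
      · simp only [Finset.mem_filter, Finset.mem_univ, true_and, hneg, if_false]
        rw [Real.norm_eq_abs, abs_of_nonneg (not_lt.mp hneg)]
        exact inv_mul_cancel₀ (hK i hi)

/-- `𝓘` is injective: a slice function determines its stem function. -/
lemma stem_unique {n : ℕ} {D : Set (Fin n → ℂ)} {F G : (Fin n → ℂ) → StemSpace n}
    (hF : IsStem D F) (hG : IsStem D G)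
    (h : Set.EqOn (induced F) (induced G) (circularization D)) : Set.EqOn F G D := by
  intro z hz
  let J : Fin n → ℍ := fun _ => quatI
  have hI : quatI ∈ imagUnits := by
    change quatI ^ 2 = -1
    rw [sq]
    ext <;> simp only [Quaternion.re_mul, Quaternion.imI_mul, Quaternion.imJ_mul,
      Quaternion.imK_mul] <;> simp [quatI]
  have hunit : ∀ c : ℝ, c = 1 ∨ c = -1 → c • quatI ∈ imagUnits := by
    rintro c (rfl | rfl)
    · rwa [one_smul]
    · change ((-1 : ℝ) • quatI) ^ 2 = -1
      rw [neg_one_smul, neg_sq]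
      exact hI
  have hJ : ∀ h, J h ∈ imagUnits := fun _ => hI
  have hsum : ∀ N : Finset (Fin n), ∑ K : Finset (Fin n),
      (∏ i ∈ N, if i ∈ K then (-1 : ℝ) else 1) • (orderedProd J K * (F z K - G z K)) = 0 := by
    intro N
    have hJN : ∀ h, (if h ∈ N then (-1 : ℝ) else 1) • J h ∈ imagUnits := by
      intro h
      apply hunit
      split_ifs <;> simp
    have h1 := h ⟨z, hz, _, hJN, rfl⟩
    rw [induced_slicePoint hF hz hJN, induced_slicePoint hG hz hJN, ← sub_eq_zero,
      ← Finset.sum_sub_distrib] at h1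
    rw [← h1]
    refine Finset.sum_congr rfl fun K _ => ?_
    rw [orderedProd_smul (fun i => if i ∈ N then (-1 : ℝ) else 1) J _ K (fun _ _ => rfl),
      ← mul_sub, smul_mul_assoc]
    congr 1
    simp only [Finset.prod_ite, Finset.prod_const, one_pow, mul_one]
    congr 2
    ext i
    simp [and_comm]
  funext K₀
  have h2 : ∑ N : Finset (Fin n), (∏ i ∈ N, if i ∈ K₀ then (-1 : ℝ) else 1) •
      ∑ K : Finset (Fin n), (∏ i ∈ N, if i ∈ K then (-1 : ℝ) else 1) •
        (orderedProd J K * (F z K - G z K)) = 0 :=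
    Finset.sum_eq_zero fun N _ => by rw [hsum N, smul_zero]
  simp_rw [Finset.smul_sum, smul_smul, ← Finset.prod_mul_distrib] at h2
  rw [Finset.sum_comm] at h2
  simp_rw [← Finset.sum_smul] at h2
  have h3 : ∀ K : Finset (Fin n), ∑ N : Finset (Fin n), ∏ i ∈ N,
      ((if i ∈ K₀ then (-1 : ℝ) else 1) * if i ∈ K then (-1 : ℝ) else 1) =
      if K = K₀ then (2 : ℝ) ^ n else 0 := by
    intro K
    rw [← Finset.powerset_univ, ← Finset.prod_one_add]
    split_ifs with hK
    · subst hK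
      rw [Finset.prod_congr rfl (g := fun _ => (2 : ℝ)) (fun i _ => by split_ifs <;> norm_num)]
      simp
    · obtain ⟨i, hi⟩ : ∃ i, ¬ (i ∈ K ↔ i ∈ K₀) := by
        by_contra hcon
        push Not at hcon
        exact hK (Finset.ext hcon)
      apply Finset.prod_eq_zero (Finset.mem_univ i)
      by_cases h4 : i ∈ K <;> by_cases h5 : i ∈ K₀ <;> simp_all
  simp_rw [h3, ite_smul, zero_smul] at h2
  rw [Finset.sum_ite_eq' Finset.univ K₀, if_pos (Finset.mem_univ _)] at h2
  have h6 := (smul_eq_zero.mp h2).resolve_left (by positivity)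
  have h7 : orderedProd J K₀ ≠ 0 := by
    rw [orderedProd]
    apply List.prod_ne_zero
    simp only [List.mem_map, not_exists, not_and]
    intro i _ h0
    have := (re_eq_zero_of_mem_imagUnits (hJ i)).2
    rw [h0, norm_zero] at this
    exact zero_ne_one this
  exact sub_eq_zero.mp ((mul_eq_zero.mp h6).resolve_left h7)

lemma sphDeriv_congr {n : ℕ} {D : Set (Fin n → ℂ)} (hD : IsOpen D) (h : Fin n)
    {F G : (Fin n → ℂ) → StemSpace n} (hFG : Set.EqOn F G D) :
    Set.EqOn (sphDeriv h F) (sphDeriv h G) D := by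
  intro z hz
  funext K
  have e : partialBeta h F z = partialBeta h G z :=
    Filter.EventuallyEq.lineDeriv_eq (Filter.mem_of_superset (hD.mem_nhds hz) hFG)
  simp only [sphDeriv, e, hFG hz]

lemma stemComponent_congr {n : ℕ} {D : Set (Fin n → ℂ)} (hD : IsOpen D) (H K : Finset (Fin n))
    {F G : (Fin n → ℂ) → StemSpace n} (hFG : Set.EqOn F G D) :
    Set.EqOn (stemComponent H K F) (stemComponent H K G) D := by
  have key : ∀ (l : List (Fin n)) (F G : (Fin n → ℂ) → StemSpace n), Set.EqOn F G D →
      Set.EqOn (l.foldl (fun G h => sphDeriv h G) F) (l.foldl (fun G h => sphDeriv h G) G) D := by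
    intro l
    induction l with
    | nil => intro F G h; simpa using h
    | cons a t ih => intro F G h; exact ih _ _ (sphDeriv_congr hD a h)
  apply key
  intro z hz
  simp only [stemMul, hFG hz]

/-- If `f = 𝓘(F)` then `𝓢^H_K(f) = 𝓘(G^H_K(F))`. -/
lemma component_eq_induced {n : ℕ} {D : Set (Fin n → ℂ)} (hD : IsOpen D)
    {F : (Fin n → ℂ) → StemSpace n} (hF : IsStem D F) {f : (Fin n → ℍ) → ℍ}
    (hf : Set.EqOn f (induced F) (circularization D)) (H K : Finset (Fin n)) :
    Set.EqOn (component D H K f) (induced (stemComponent H K F)) (circularization D) := by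
  have hs : IsSlice D f := ⟨F, hF, hf⟩
  have hu : Set.EqOn (stemOf D f) F D := by
    rw [stemOf, dif_pos hs]
    exact stem_unique hs.choose_spec.1 hF (hs.choose_spec.2.symm.trans hf)
  intro x hx
  simp only [component, induced,
    stemComponent_congr hD H K hu (hF.complexCoord_mem hx)]

end

end SliceSeveral

open scoped Quaternion

namespace SliceSeveral

open MeasureTheory Filter Topology Set Metric

noncomputable section

/-! The formula is a one-variable identity applied successively to the variables `x_1, …, x_m`.

One variable. Write `f = A + im(x) S`, where `A` and the spherical derivative `S` depend only on the
point `α + iβ` of the half plane that represents the sphere through `x`. At `q = b + rλ` one has `im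
q + r λ̄ = (re q - re b) + im b`, so `f(q) + r λ̄ S(q) = T(q) + im(b) S(q)` with `T = A + (re q - re
b) S`. Both `S` and `T` are spherical derivatives of slice regular functions: with `B = βS`, they
are the quotients by `β` of the imaginary parts of `A + iB` and of `(z - re b)(A + iB)`. Such
functions have the mean value property on 3-spheres, and `T(b) = A(b)`; averaging gives `f(b)`. This
is `slice_mean_value`.

The mean value property (`mean_value`). A rotation about the real axis moves the centre to `b₀ +
iβ₀`. The integrand then depends only on the first two coordinates of `λ`, and their joint law is
uniform on the unit disc (`map_planeProj_sigma`). On each chord of the disc a change of variable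
replaces `Im ψ / β` by `β₀⁻¹ Im ψ` (`intervalIntegral_sphereHalfPlane`), and the area mean value
property of the holomorphic function `ψ` concludes. Real centres are reached by a limit.

Several variables. After spherical differentiation in the first `m` variables, only the components
`F_K` with `K` disjoint from these variables survive. Hence the unit `J_{m+1}` is the leftmost one,
and the one-variable formula applies to `x_{m+1}` with the other variables frozen
(`induced_mean_value`). Multiplying on the left by `λ̄_1 ⋯ λ̄_m` and integrating splits the
remainder of the formula for `m` into the term `j = m` and the remainder for `m + 1`.

Regularity. The quotient by `β_h` destroys holomorphy in `x_h` but keeps continuity and holomorphy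
in the remaining variables, also across `β_h = 0` (`IsHolomorphicIn.sphDeriv`). That is enough,
since each variable is used once. -/

/-! ### The normalized surface measure of the sphere -/

/-- The quaternion with given coordinates. -/
def quat (a b c d : ℝ) : ℍ := ⟨a, b, c, d⟩

@[simp] lemma quat_re (a b c d : ℝ) : (quat a b c d).re = a := rfl
@[simp] lemma quat_imI (a b c d : ℝ) : (quat a b c d).imI = b := rfl
@[simp] lemma quat_imJ (a b c d : ℝ) : (quat a b c d).imJ = c := rfl
@[simp] lemma quat_imK (a b c d : ℝ) : (quat a b c d).imK = d := rfl

lemma norm_sq_eq_sum_sq (x : ℍ) :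
    ‖x‖ ^ 2 = x.re ^ 2 + x.imI ^ 2 + x.imJ ^ 2 + x.imK ^ 2 := by
  rw [sq, ← Quaternion.normSq_eq_norm_mul_self, Quaternion.normSq_def']

lemma norm_le_sum_abs (x : ℍ) : ‖x‖ ≤ |x.re| + |x.imI| + |x.imJ| + |x.imK| := by
  refine le_of_sq_le_sq ?_ (by positivity)
  rw [norm_sq_eq_sum_sq, ← sq_abs x.re, ← sq_abs x.imI, ← sq_abs x.imJ, ← sq_abs x.imK]
  have := abs_nonneg x.re
  have := abs_nonneg x.imI
  have := abs_nonneg x.imJ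
  have := abs_nonneg x.imK
  nlinarith [mul_nonneg ‹0 ≤ |x.re|› ‹0 ≤ |x.imI|›, mul_nonneg ‹0 ≤ |x.re|› ‹0 ≤ |x.imJ|›,
    mul_nonneg ‹0 ≤ |x.re|› ‹0 ≤ |x.imK|›, mul_nonneg ‹0 ≤ |x.imI|› ‹0 ≤ |x.imJ|›,
    mul_nonneg ‹0 ≤ |x.imI|› ‹0 ≤ |x.imK|›, mul_nonneg ‹0 ≤ |x.imJ|› ‹0 ≤ |x.imK|›]

instance : ProperSpace ℍ := FiniteDimensional.proper_real ℍ

lemma sum_sq_sphere (x : Sphere3) :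
    (x : ℍ).re ^ 2 + (x : ℍ).imI ^ 2 + (x : ℍ).imJ ^ 2 + (x : ℍ).imK ^ 2 = 1 := by
  rw [← norm_sq_eq_sum_sq, norm_eq_of_mem_sphere]
  norm_num

/-- Hopf coordinates on `𝕊³`. -/
def hopf (p : Fin 3 → ℝ) : Sphere3 :=
  ⟨quat (Real.cos (p 0) * Real.cos (p 1)) (Real.cos (p 0) * Real.sin (p 1))
    (Real.sin (p 0) * Real.cos (p 2)) (Real.sin (p 0) * Real.sin (p 2)), by
    rw [mem_sphere_zero_iff_norm, ← sq_eq_sq₀ (norm_nonneg _) zero_le_one, norm_sq_eq_sum_sq]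
    have h0 := Real.sin_sq_add_cos_sq (p 0)
    have h1 := Real.sin_sq_add_cos_sq (p 1)
    have h2 := Real.sin_sq_add_cos_sq (p 2)
    simp only [quat_re, quat_imI, quat_imJ, quat_imK]
    linear_combination Real.cos (p 0) ^ 2 * h1 + Real.sin (p 0) ^ 2 * h2 + h0⟩

/-- Each of the four coordinates is a product of two 1-Lipschitz functions bounded by 1, hence
2-Lipschitz; the norm is at most the sum of the four, whence 8. -/
lemma lipschitzWith_hopf : LipschitzWith 8 hopf := by
  refine LipschitzWith.of_dist_le_mul fun p q => ?_
  have key : ∀ a b a' b' : ℝ, |a| ≤ 1 → |b'| ≤ 1 → |a - a'| ≤ dist p q → |b - b'| ≤ dist p q →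
      |a * b - a' * b'| ≤ 2 * dist p q := by
    intro a b a' b' ha hb hda hdb
    have e : a * b - a' * b' = a * (b - b') + (a - a') * b' := by ring
    rw [e]
    refine (abs_add_le _ _).trans ?_
    rw [abs_mul, abs_mul]
    nlinarith [abs_nonneg (b - b'), abs_nonneg (a - a'), abs_nonneg a, abs_nonneg b',
      mul_le_mul ha hdb (abs_nonneg _) zero_le_one, mul_le_mul hda hb (abs_nonneg _) dist_nonneg]
  have hd : ∀ i, |p i - q i| ≤ dist p q := fun i => by
    rw [← Real.dist_eq]; exact dist_le_pi_dist p q i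
  have hc : ∀ i, |Real.cos (p i) - Real.cos (q i)| ≤ dist p q := fun i =>
    (Real.abs_cos_sub_cos_le _ _).trans (hd i)
  have hs : ∀ i, |Real.sin (p i) - Real.sin (q i)| ≤ dist p q := fun i =>
    (Real.abs_sin_sub_sin_le _ _).trans (hd i)
  rw [Subtype.dist_eq, dist_eq_norm]
  refine (norm_le_sum_abs _).trans ?_
  have h1 := key _ _ _ _ (Real.abs_cos_le_one (p 0)) (Real.abs_cos_le_one (q 1)) (hc 0) (hc 1)
  have h2 := key _ _ _ _ (Real.abs_cos_le_one (p 0)) (Real.abs_sin_le_one (q 1)) (hc 0) (hs 1)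
  have h3 := key _ _ _ _ (Real.abs_sin_le_one (p 0)) (Real.abs_cos_le_one (q 2)) (hs 0) (hc 2)
  have h4 := key _ _ _ _ (Real.abs_sin_le_one (p 0)) (Real.abs_sin_le_one (q 2)) (hs 0) (hs 2)
  simp only [hopf, Quaternion.re_sub, Quaternion.imI_sub, Quaternion.imJ_sub,
    Quaternion.imK_sub, quat_re, quat_imI, quat_imJ, quat_imK]
  push_cast
  linarith

/-- Viewing `x` as `(z, w)` in `ℂ × ℂ`, the three angles are the arguments of `‖z‖ + i‖w‖`, of `z`
and of `w`. They lie in `(-π, π]`, and 4 is just a convenient bound for `π`. -/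
lemma surjOn_hopf : (univ : Set Sphere3) ⊆ hopf '' (univ.pi fun _ => Icc (-4) 4) := by
  intro x _
  have hx := sum_sq_sphere x
  set z : ℂ := ⟨(x : ℍ).re, (x : ℍ).imI⟩ with hz
  set w : ℂ := ⟨(x : ℍ).imJ, (x : ℍ).imK⟩ with hw
  have hzw : ‖z‖ ^ 2 + ‖w‖ ^ 2 = 1 := by
    rw [← Complex.normSq_eq_norm_sq, ← Complex.normSq_eq_norm_sq, Complex.normSq_apply,
      Complex.normSq_apply]
    simp only [hz, hw]; linarith
  set v : ℂ := ⟨‖z‖, ‖w‖⟩ with hv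
  have hvn : ‖v‖ = 1 := by
    rw [← sq_eq_sq₀ (norm_nonneg _) zero_le_one, ← Complex.normSq_eq_norm_sq,
      Complex.normSq_apply]
    simp only [hv]; linarith
  have hc : Real.cos v.arg = ‖z‖ := by
    have := Complex.norm_mul_cos_arg v; rwa [hvn, one_mul] at this
  have hs : Real.sin v.arg = ‖w‖ := by
    have := Complex.norm_mul_sin_arg v; rwa [hvn, one_mul] at this
  have hI : ∀ u : ℂ, u.arg ∈ Icc (-4 : ℝ) 4 := fun u =>
    ⟨by linarith [Complex.neg_pi_lt_arg u, Real.pi_lt_four],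
      by linarith [Complex.arg_le_pi u, Real.pi_lt_four]⟩
  refine ⟨![v.arg, z.arg, w.arg], ?_, ?_⟩
  · intro i _
    fin_cases i
    · exact hI v
    · exact hI z
    · exact hI w
  · apply Subtype.ext
    simp only [hopf, Matrix.cons_val_zero, Matrix.cons_val_one, Matrix.cons_val, hc, hs,
      Complex.norm_mul_cos_arg, Complex.norm_mul_sin_arg]
    rfl

lemma hausdorffMeasure_three_real :
    (Measure.hausdorffMeasure 3 : Measure (Fin 3 → ℝ)) = volume := by
  rw [← hausdorffMeasure_pi_real]
  norm_num

lemma hausdorffMeasure_sphere_ne_top :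
    Measure.hausdorffMeasure 3 (univ : Set Sphere3) ≠ ⊤ := by
  refine ne_top_of_le_ne_top ?_ (measure_mono surjOn_hopf)
  refine ne_top_of_le_ne_top ?_
    (lipschitzWith_hopf.hausdorffMeasure_image_le (by norm_num : (0 : ℝ) ≤ 3) _)
  rw [hausdorffMeasure_three_real]
  refine ENNReal.mul_ne_top (by simp) ?_
  exact (isCompact_univ_pi fun _ => isCompact_Icc).measure_lt_top.ne

/-- Projecting to three coordinates does not increase distances, and the image contains a sup-norm
ball of radius 1/2, because three squares below 1/4 leave room for a fourth coordinate. -/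
lemma hausdorffMeasure_sphere_ne_zero :
    Measure.hausdorffMeasure 3 (univ : Set Sphere3) ≠ 0 := by
  let p : Sphere3 → Fin 3 → ℝ := fun x => ![(x : ℍ).re, (x : ℍ).imI, (x : ℍ).imJ]
  have hp : LipschitzWith 1 p := by
    refine LipschitzWith.of_dist_le_mul fun x y => ?_
    rw [NNReal.coe_one, one_mul, dist_pi_le_iff dist_nonneg]
    intro i
    rw [Subtype.dist_eq, Real.dist_eq, dist_eq_norm]
    refine le_of_sq_le_sq ?_ (norm_nonneg _)
    rw [norm_sq_eq_sum_sq, sq_abs]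
    have h0 := sq_nonneg ((x : ℍ) - y).re
    have h1 := sq_nonneg ((x : ℍ) - y).imI
    have h2 := sq_nonneg ((x : ℍ) - y).imJ
    have h3 := sq_nonneg ((x : ℍ) - y).imK
    simp only [Quaternion.re_sub, Quaternion.imI_sub, Quaternion.imJ_sub,
      Quaternion.imK_sub] at h0 h1 h2 h3 ⊢
    fin_cases i <;> simp [p] <;> linarith
  have hsub : ball (0 : Fin 3 → ℝ) (1 / 2) ⊆ p '' univ := by
    intro y hy
    have hy' : ∀ i, |y i| < 1 / 2 := fun i => by
      rw [mem_ball_zero_iff] at hy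
      exact (norm_le_pi_norm y i).trans_lt hy
    have hs : ∀ i, y i ^ 2 ≤ 1 / 4 := fun i => by
      have := hy' i
      rw [← sq_abs]; nlinarith [abs_nonneg (y i)]
    have h0 : 0 ≤ 1 - y 0 ^ 2 - y 1 ^ 2 - y 2 ^ 2 := by linarith [hs 0, hs 1, hs 2]
    refine ⟨⟨quat (y 0) (y 1) (y 2) √(1 - y 0 ^ 2 - y 1 ^ 2 - y 2 ^ 2), ?_⟩, mem_univ _, ?_⟩
    · rw [mem_sphere_zero_iff_norm, ← sq_eq_sq₀ (norm_nonneg _) zero_le_one, norm_sq_eq_sum_sq]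
      simp only [quat_re, quat_imI, quat_imJ, quat_imK, Real.sq_sqrt h0]; ring
    · funext i
      fin_cases i <;> rfl
  have h1 := hp.hausdorffMeasure_image_le (by norm_num : (0 : ℝ) ≤ 3) univ
  intro h0
  rw [h0, mul_zero, hausdorffMeasure_three_real] at h1
  have h2 := (measure_mono hsub).trans h1
  exact (isOpen_ball.measure_pos volume ⟨0, by simp⟩).not_ge h2

instance : IsProbabilityMeasure sigma :=
  ⟨by
    rw [sigma, Measure.smul_apply, smul_eq_mul]
    exact ENNReal.inv_mul_cancel hausdorffMeasure_sphere_ne_zero hausdorffMeasure_sphere_ne_top⟩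

instance (k : ℕ) : IsProbabilityMeasure (sigmaPow k) := by
  unfold sigmaPow; infer_instance

lemma map_sigma_isometryEquiv (e : Sphere3 ≃ᵢ Sphere3) : sigma.map e = sigma := by
  rw [sigma, Measure.map_smul, e.map_hausdorffMeasure]

/-! ### The projection of the sphere to a plane is uniformly distributed on the disc -/

open scoped ENNReal

/-- Polar coordinates and `v = r²`. The density of the squared radius in the plane is constant,
which is why the projection of `𝕊³` turns out to be uniform. -/
lemma lintegral_norm_sq (k : ℝ → ℝ≥0∞) (hk : Measurable k) :
    ∫⁻ z : ℂ, k (‖z‖ ^ 2) = ENNReal.ofReal Real.pi * ∫⁻ v in Ioi 0, k v := by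
  rw [← Complex.lintegral_comp_polarCoord_symm]
  have e1 : ∫⁻ v in Ioi (0 : ℝ), k v = ∫⁻ r in Ioi (0 : ℝ), ENNReal.ofReal (2 * r) * k (r ^ 2) := by
    have himg : (fun r : ℝ => r ^ 2) '' Ioi 0 = Ioi 0 := by
      ext v
      constructor
      · rintro ⟨r, hr, rfl⟩
        exact pow_pos (mem_Ioi.1 hr) 2
      · intro hv
        exact ⟨√v, Real.sqrt_pos.2 hv, Real.sq_sqrt (le_of_lt hv)⟩
    have h := lintegral_image_eq_lintegral_abs_deriv_mul (s := Ioi (0 : ℝ))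
      (f := fun r => r ^ 2) (f' := fun r => 2 * r) measurableSet_Ioi
      (fun x _ => by simpa using (hasDerivAt_pow 2 x).hasDerivWithinAt)
      (fun x hx y hy hxy => (sq_eq_sq₀ (le_of_lt hx) (le_of_lt hy)).1 hxy) k
    rw [himg] at h
    rw [h]
    refine setLIntegral_congr_fun measurableSet_Ioi fun r hr => ?_
    rw [abs_of_pos (mul_pos two_pos hr)]
  rw [e1]
  have e2 : ∀ p : ℝ × ℝ, ENNReal.ofReal p.1 • k (‖Complex.polarCoord.symm p‖ ^ 2) =
      ENNReal.ofReal p.1 * k (p.1 ^ 2) := fun p => by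
    rw [Complex.norm_polarCoord_symm, sq_abs, smul_eq_mul]
  simp_rw [e2]
  have hm : Measurable fun r : ℝ => ENNReal.ofReal r * k (r ^ 2) := by fun_prop
  rw [polarCoord_target, Measure.volume_eq_prod, ← Measure.prod_restrict,
    lintegral_prod _ (by fun_prop)]
  simp only [lintegral_const, Measure.restrict_apply_univ, Real.volume_Ioo]
  rw [lintegral_mul_const _ hm, mul_comm, sub_neg_eq_add, ← two_mul,
    ENNReal.ofReal_mul zero_le_two, mul_comm (ENNReal.ofReal 2), mul_assoc]
  congr 1
  rw [← lintegral_const_mul _ hm]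
  refine lintegral_congr fun r => ?_
  rw [← mul_assoc, ← ENNReal.ofReal_mul zero_le_two]

lemma lintegral_inv_sqrt_smul (H : ℂ → ℝ≥0∞) (hH : Measurable H) {u : ℝ} (hu : 0 < u) :
    ∫⁻ z : ℂ, H ((√u)⁻¹ • z) = ENNReal.ofReal u * ∫⁻ z, H z := by
  have hr : (√u)⁻¹ ≠ 0 := inv_ne_zero (Real.sqrt_pos.2 hu).ne'
  have h := Measure.map_addHaar_smul (volume : Measure ℂ) hr
  have h2 : ∫⁻ z, H z ∂(Measure.map ((√u)⁻¹ • ·) (volume : Measure ℂ)) =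
      ∫⁻ z : ℂ, H ((√u)⁻¹ • z) :=
    lintegral_map hH (measurable_const_smul _)
  rw [← h2, h, lintegral_smul_measure, Complex.finrank_real_complex, inv_pow, inv_inv,
    Real.sq_sqrt hu.le, abs_of_pos hu, smul_eq_mul]

/-- For fixed `z = p.1`, the variable `u = ‖z‖² + ‖w‖²` turns the integral over `w` into `π du` on
`u > ‖z‖²`. After exchanging the integrals, rescaling `z` by `√u` produces the factor `u` and the
unit disc. -/
lemma lintegral_radial_projection (h : ℂ → ℝ≥0∞) (hh : Measurable h) :
    ∫⁻ p : ℂ × ℂ, (if ‖p.1‖ ^ 2 + ‖p.2‖ ^ 2 < 1 then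
      h ((√(‖p.1‖ ^ 2 + ‖p.2‖ ^ 2))⁻¹ • p.1) else 0) =
    (ENNReal.ofReal Real.pi * ∫⁻ u in Ioo (0 : ℝ) 1, ENNReal.ofReal u) *
      ∫⁻ w in ball (0 : ℂ) 1, h w := by
  have hmeas : Measurable fun q : ℂ × ℝ => if q.2 < 1 then h ((√q.2)⁻¹ • q.1) else 0 := by
    refine Measurable.ite (measurableSet_lt measurable_snd measurable_const) ?_ measurable_const
    fun_prop
  have hm : Measurable fun p : ℂ × ℂ => (if ‖p.1‖ ^ 2 + ‖p.2‖ ^ 2 < 1 then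
      h ((√(‖p.1‖ ^ 2 + ‖p.2‖ ^ 2))⁻¹ • p.1) else 0) :=
    hmeas.comp (f := fun p : ℂ × ℂ => (p.1, ‖p.1‖ ^ 2 + ‖p.2‖ ^ 2)) (by fun_prop)
  rw [Measure.volume_eq_prod, lintegral_prod _ hm.aemeasurable]
  have e1 : ∀ z : ℂ, ∫⁻ w : ℂ, (if ‖z‖ ^ 2 + ‖w‖ ^ 2 < 1 then
      h ((√(‖z‖ ^ 2 + ‖w‖ ^ 2))⁻¹ • z) else 0) = ENNReal.ofReal Real.pi *
      ∫⁻ u : ℝ, (if ‖z‖ ^ 2 < u then (if u < 1 then h ((√u)⁻¹ • z) else 0) else 0) := by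
    intro z
    rw [lintegral_norm_sq (fun v => if ‖z‖ ^ 2 + v < 1 then h ((√(‖z‖ ^ 2 + v))⁻¹ • z) else 0)
      (hmeas.comp (f := fun v : ℝ => (z, ‖z‖ ^ 2 + v)) (by fun_prop))]
    congr 1
    rw [← lintegral_indicator measurableSet_Ioi]
    refine Eq.trans ?_ (lintegral_add_left_eq_self _ (‖z‖ ^ 2))
    refine lintegral_congr fun v => ?_
    simp [indicator_apply]
  simp_rw [e1]
  have hm2 : Measurable fun q : ℂ × ℝ =>
      (if ‖q.1‖ ^ 2 < q.2 then (if q.2 < 1 then h ((√q.2)⁻¹ • q.1) else 0) else 0) :=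
    Measurable.ite (measurableSet_lt (by fun_prop) measurable_snd) hmeas measurable_const
  rw [lintegral_const_mul _ hm2.lintegral_prod_right', mul_assoc]
  congr 1
  rw [lintegral_lintegral_swap hm2.aemeasurable,
    ← lintegral_mul_const _ ENNReal.measurable_ofReal, ← lintegral_indicator measurableSet_Ioo]
  refine lintegral_congr fun u => ?_
  by_cases hu : u ∈ Ioo (0 : ℝ) 1
  · rw [indicator_of_mem hu, ← lintegral_indicator measurableSet_ball,
      ← lintegral_inv_sqrt_smul _ (hh.indicator measurableSet_ball) hu.1]
    refine lintegral_congr fun z => ?_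
    have hiff : ‖z‖ ^ 2 < u ↔ (√u)⁻¹ • z ∈ ball (0 : ℂ) 1 := by
      rw [mem_ball_zero_iff, norm_smul, norm_inv, Real.norm_eq_abs,
        abs_of_pos (Real.sqrt_pos.2 hu.1), inv_mul_lt_iff₀ (Real.sqrt_pos.2 hu.1), mul_one,
        Real.lt_sqrt (norm_nonneg _)]
    simp only [hu.2, if_true]
    by_cases hz : ‖z‖ ^ 2 < u
    · rw [if_pos hz, indicator_of_mem (hiff.1 hz)]
    · rw [if_neg hz, indicator_of_notMem (mt hiff.2 hz)]
  · rw [indicator_of_notMem hu]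
    refine (lintegral_congr fun z => ?_).trans lintegral_zero
    simp only [mem_Ioo, not_and, not_lt] at hu
    split_ifs with h1 h2
    · exact absurd h2 (not_lt.2 (hu ((sq_nonneg _).trans_lt h1)))
    · rfl
    · rfl

/-- The coordinates of `ℍ` in `ℂ × ℂ`. -/
def complexPairEquiv : (ℂ × ℂ) ≃L[ℝ] ℍ :=
  LinearEquiv.toContinuousLinearEquiv
    { toFun := fun p => quat p.1.re p.1.im p.2.re p.2.im
      invFun := fun x => (⟨x.re, x.imI⟩, ⟨x.imJ, x.imK⟩)
      map_add' := fun p q => by ext <;> simp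
      map_smul' := fun c p => by ext <;> simp
      left_inv := fun p => rfl
      right_inv := fun x => rfl }

lemma complexPairEquiv_apply (p : ℂ × ℂ) :
    complexPairEquiv p = quat p.1.re p.1.im p.2.re p.2.im := rfl

lemma norm_sq_complexPairEquiv (p : ℂ × ℂ) :
    ‖complexPairEquiv p‖ ^ 2 = ‖p.1‖ ^ 2 + ‖p.2‖ ^ 2 := by
  rw [norm_sq_eq_sum_sq, ← Complex.normSq_eq_norm_sq, ← Complex.normSq_eq_norm_sq,
    Complex.normSq_apply, Complex.normSq_apply, complexPairEquiv_apply]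
  simp only [quat_re, quat_imI, quat_imJ, quat_imK]
  ring

/-- Lebesgue measure on `ℍ`, transported from `ℂ × ℂ`. -/
def quatVolume : Measure ℍ := (volume : Measure (ℂ × ℂ)).map complexPairEquiv

instance : (volume : Measure (ℂ × ℂ)).IsAddHaarMeasure := by
  rw [Measure.volume_eq_prod]; infer_instance

instance : quatVolume.IsAddHaarMeasure := by
  unfold quatVolume; exact complexPairEquiv.isAddHaarMeasure_map _

/-- Left multiplication by a unit quaternion. -/
def leftMulIsometry (u : Sphere3) : ℍ ≃ₗᵢ[ℝ] ℍ where
  toFun x := (u : ℍ) * x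
  invFun x := ((u⁻¹ : Sphere3) : ℍ) * x
  map_add' x y := mul_add _ _ _
  map_smul' c x := mul_smul_comm _ _ _
  left_inv x := by
    change ((u⁻¹ : Sphere3) : ℍ) * ((u : ℍ) * x) = x
    rw [← mul_assoc, ← Metric.unitSphere.coe_mul, inv_mul_cancel, Metric.unitSphere.coe_one, one_mul]
  right_inv x := by
    change (u : ℍ) * (((u⁻¹ : Sphere3) : ℍ) * x) = x
    rw [← mul_assoc, ← Metric.unitSphere.coe_mul, mul_inv_cancel, Metric.unitSphere.coe_one, one_mul]
  norm_map' x := by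
    change ‖(u : ℍ) * x‖ = ‖x‖
    rw [norm_mul, norm_eq_of_mem_sphere, one_mul]

lemma leftMulIsometry_apply (u : Sphere3) (x : ℍ) : leftMulIsometry u x = u * x := rfl

/-- By uniqueness of Haar measure `quatVolume` is a multiple of the volume of the inner product
space `ℍ`, which isometries preserve. -/
lemma map_quatVolume_isometry (e : ℍ ≃ₗᵢ[ℝ] ℍ) : quatVolume.map e = quatVolume := by
  rw [Measure.isAddLeftInvariant_eq_smul quatVolume volume, Measure.map_smul,
    e.measurePreserving.map_eq]

/-- The isometry of the sphere induced by a linear isometry. -/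
def sphereIsometry (e : ℍ ≃ₗᵢ[ℝ] ℍ) : Sphere3 ≃ᵢ Sphere3 where
  toFun x := ⟨e x, by
    rw [mem_sphere_zero_iff_norm, e.norm_map, norm_eq_of_mem_sphere]⟩
  invFun x := ⟨e.symm x, by
    rw [mem_sphere_zero_iff_norm, e.symm.norm_map, norm_eq_of_mem_sphere]⟩
  left_inv x := Subtype.ext (e.symm_apply_apply x)
  right_inv x := Subtype.ext (e.apply_symm_apply x)
  isometry_toFun := Isometry.of_dist_eq fun x y => by
    rw [Subtype.dist_eq, Subtype.dist_eq]; exact e.dist_map x y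

instance : sigma.IsMulLeftInvariant :=
  ⟨fun u => map_sigma_isometryEquiv (sphereIsometry (leftMulIsometry u))⟩

open Classical in
/-- The radial projection onto `𝕊³` (with an irrelevant value at `0`). -/
def radialProj (x : ℍ) : Sphere3 :=
  ⟨if x = 0 then 1 else ‖x‖⁻¹ • x, by
    rw [mem_sphere_zero_iff_norm]
    split_ifs with h
    · exact norm_one
    · rw [norm_smul, norm_inv, norm_norm, inv_mul_cancel₀ (norm_ne_zero_iff.2 h)]⟩

lemma coe_radialProj {x : ℍ} (hx : x ≠ 0) : (radialProj x : ℍ) = ‖x‖⁻¹ • x := if_neg hx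

lemma measurable_radialProj : Measurable radialProj := by
  refine Measurable.subtype_mk (Measurable.ite (measurableSet_singleton 0) measurable_const ?_)
  fun_prop

/-- The push-forward of the Lebesgue measure of the unit ball under the radial projection. -/
def ballProjMeasure : Measure Sphere3 := (quatVolume.restrict (ball 0 1)).map radialProj

instance : IsFiniteMeasure (quatVolume.restrict (ball (0 : ℍ) 1)) :=
  ⟨by rw [Measure.restrict_apply_univ]; exact measure_ball_lt_top⟩

instance : IsFiniteMeasure ballProjMeasure := by unfold ballProjMeasure; infer_instance

instance : ballProjMeasure.IsMulLeftInvariant := by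
  refine ⟨fun u => ?_⟩
  have hmul : Measurable fun x : Sphere3 => u * x := (continuous_const_mul u).measurable
  have hL : Measurable (leftMulIsometry u) := (leftMulIsometry u).continuous.measurable
  have hae : (fun x => u * radialProj x) =ᵐ[quatVolume.restrict (ball 0 1)]
      fun x => radialProj (leftMulIsometry u x) := by
    refine ae_restrict_of_ae ?_
    have h0 : ∀ᵐ x ∂quatVolume, x ≠ 0 := by
      rw [ae_iff]; simp
    filter_upwards [h0] with x hx
    apply Subtype.ext
    have hx' : leftMulIsometry u x ≠ 0 := by simpa using hx
    rw [coe_radialProj hx', (leftMulIsometry u).norm_map, Metric.unitSphere.coe_mul,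
      coe_radialProj hx, leftMulIsometry_apply, mul_smul_comm]
  have hres : (quatVolume.restrict (ball 0 1)).map (leftMulIsometry u) =
      quatVolume.restrict (ball 0 1) := by
    have hpre : (leftMulIsometry u) ⁻¹' ball 0 1 = ball 0 1 := by
      ext x; simp
    conv_lhs => rw [← hpre]
    rw [← Measure.restrict_map hL measurableSet_ball, map_quatVolume_isometry]
  unfold ballProjMeasure
  rw [Measure.map_map hmul measurable_radialProj]
  change Measure.map (fun x => u * radialProj x) _ = _
  rw [Measure.map_congr hae]
  change Measure.map (radialProj ∘ leftMulIsometry u) _ = _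
  rw [← Measure.map_map measurable_radialProj hL, hres]

/-- Both measures are left invariant on the compact group of unit quaternions, so uniqueness of Haar
measure applies. This replaces Hausdorff measure by a Lebesgue integral that can be computed. -/
lemma ballProjMeasure_eq : ballProjMeasure = ballProjMeasure univ • sigma := by
  have h1 := Measure.haarMeasure_unique ballProjMeasure (⊤ : TopologicalSpace.PositiveCompacts Sphere3)
  have h2 := Measure.haarMeasure_unique sigma (⊤ : TopologicalSpace.PositiveCompacts Sphere3)
  rw [TopologicalSpace.PositiveCompacts.coe_top] at h1 h2
  rw [measure_univ, one_smul] at h2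
  rw [← h2] at h1
  exact h1

/-- The projection of the sphere to the plane of the first two coordinates. -/
def planeProj (x : Sphere3) : ℂ := ⟨(x : ℍ).re, (x : ℍ).imI⟩

lemma continuous_planeProj : Continuous planeProj :=
  Complex.equivRealProdCLM.symm.continuous.comp
    ((Quaternion.continuous_re.comp continuous_subtype_val).prodMk
      (Quaternion.continuous_imI.comp continuous_subtype_val))

lemma ballProjMeasure_preimage {A : Set ℂ} (hA : MeasurableSet A) :
    ballProjMeasure (planeProj ⁻¹' A) =
    (ENNReal.ofReal Real.pi * ∫⁻ u in Ioo (0 : ℝ) 1, ENNReal.ofReal u) *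
      volume.restrict (ball (0 : ℂ) 1) A := by
  have hpA : MeasurableSet (planeProj ⁻¹' A) := continuous_planeProj.measurable hA
  have hind : Measurable (A.indicator (1 : ℂ → ENNReal)) := measurable_one.indicator hA
  rw [← lintegral_indicator_one hA, ← lintegral_radial_projection _ hind, ballProjMeasure,
    Measure.map_apply measurable_radialProj hpA,
    Measure.restrict_apply (measurable_radialProj hpA), quatVolume,
    Measure.map_apply complexPairEquiv.continuous.measurable
      ((measurable_radialProj hpA).inter measurableSet_ball),
    ← lintegral_indicator_one (complexPairEquiv.continuous.measurable
      ((measurable_radialProj hpA).inter measurableSet_ball))]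
  have h0 : ∀ᵐ p : ℂ × ℂ, p ≠ 0 := by rw [ae_iff]; simp
  refine lintegral_congr_ae ?_
  filter_upwards [h0] with p hp
  have hp' : complexPairEquiv p ≠ 0 := by simpa using hp
  have hn : ‖complexPairEquiv p‖ = √(‖p.1‖ ^ 2 + ‖p.2‖ ^ 2) := by
    rw [← norm_sq_complexPairEquiv, Real.sqrt_sq (norm_nonneg _)]
  have hproj : planeProj (radialProj (complexPairEquiv p)) =
      (√(‖p.1‖ ^ 2 + ‖p.2‖ ^ 2))⁻¹ • p.1 := by
    rw [planeProj, coe_radialProj hp', hn]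
    apply Complex.ext <;> simp [complexPairEquiv_apply]
  have hball : complexPairEquiv p ∈ ball (0 : ℍ) 1 ↔ ‖p.1‖ ^ 2 + ‖p.2‖ ^ 2 < 1 := by
    rw [mem_ball_zero_iff, ← norm_sq_complexPairEquiv, sq_lt_one_iff₀ (norm_nonneg _)]
  by_cases hb : ‖p.1‖ ^ 2 + ‖p.2‖ ^ 2 < 1
  · rw [if_pos hb]
    by_cases ha : (√(‖p.1‖ ^ 2 + ‖p.2‖ ^ 2))⁻¹ • p.1 ∈ A
    · have hmem : p ∈ complexPairEquiv ⁻¹' (radialProj ⁻¹' (planeProj ⁻¹' A) ∩ ball 0 1) :=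
        ⟨by rw [mem_preimage, mem_preimage, hproj]; exact ha, hball.2 hb⟩
      rw [indicator_of_mem ha, indicator_of_mem hmem]
      rfl
    · rw [indicator_of_notMem ha, indicator_of_notMem fun h => ha (hproj ▸ h.1)]
  · rw [if_neg hb, indicator_of_notMem fun h => hb (hball.1 h.2)]

/-- The analogue for `𝕊³` of Archimedes' hat-box theorem. The constant `C` need not be evaluated:
testing on the whole plane gives `T = C * V`, which fixes the normalization. -/
lemma map_planeProj_sigma :
    sigma.map planeProj = (volume (ball (0 : ℂ) 1))⁻¹ • volume.restrict (ball (0 : ℂ) 1) := by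
  set C := ENNReal.ofReal Real.pi * ∫⁻ u in Ioo (0 : ℝ) 1, ENNReal.ofReal u
  set V := volume (ball (0 : ℂ) 1) with hV
  set T := ballProjMeasure univ with hT
  have hV0 : V ≠ 0 := (measure_ball_pos volume (0 : ℂ) one_pos).ne'
  have hVt : V ≠ ⊤ := measure_ball_lt_top.ne
  have hTt : T ≠ ⊤ := measure_ne_top _ _
  have hT0 : T ≠ 0 := by
    rw [hT, ballProjMeasure, Measure.map_apply measurable_radialProj .univ, preimage_univ,
      Measure.restrict_apply_univ]
    exact (measure_ball_pos quatVolume (0 : ℍ) one_pos).ne'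
  have hCV : T = C * V := by
    have := ballProjMeasure_preimage MeasurableSet.univ
    rwa [preimage_univ, Measure.restrict_apply_univ] at this
  ext A hA
  have h := ballProjMeasure_preimage hA
  rw [ballProjMeasure_eq, Measure.smul_apply, smul_eq_mul, ← hT] at h
  rw [Measure.map_apply continuous_planeProj.measurable hA, Measure.smul_apply, smul_eq_mul,
    ← ENNReal.mul_right_inj hT0 hTt, h, ← mul_assoc]
  congr 1
  rw [hCV, mul_assoc, ENNReal.mul_inv_cancel hV0 hVt, mul_one]

/-! ### Integrals over the unit disc -/

lemma mk_mem_ball_iff (s t : ℝ) : (⟨s, t⟩ : ℂ) ∈ ball (0 : ℂ) 1 ↔ s ^ 2 + t ^ 2 < 1 := by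
  rw [mem_ball_zero_iff, ← sq_lt_one_iff₀ (norm_nonneg _), ← Complex.normSq_eq_norm_sq,
    Complex.normSq_apply, sq, sq]

lemma mk_mem_closedBall_iff (s t : ℝ) :
    (⟨s, t⟩ : ℂ) ∈ closedBall (0 : ℂ) 1 ↔ s ^ 2 + t ^ 2 ≤ 1 := by
  rw [mem_closedBall_zero_iff, ← sq_le_one_iff₀ (norm_nonneg _), ← Complex.normSq_eq_norm_sq,
    Complex.normSq_apply, sq, sq]

lemma setIntegral_disc_eq_iterated {F : ℂ → ℝ} (hF : IntegrableOn F (ball 0 1)) :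
    ∫ w in ball (0 : ℂ) 1, F w =
      ∫ s : ℝ, if |s| < 1 then ∫ t in -√(1 - s ^ 2)..√(1 - s ^ 2), F ⟨s, t⟩ else 0 := by
  have e := Complex.volume_preserving_equiv_real_prod.symm
  rw [← integral_indicator measurableSet_ball,
    ← e.integral_comp Complex.measurableEquivRealProd.symm.measurableEmbedding,
    Measure.volume_eq_prod, integral_prod]
  · refine integral_congr_ae (Eventually.of_forall fun s => ?_)
    simp only [Complex.measurableEquivRealProd_symm_apply]
    split_ifs with hs
    · have h0 : 0 < 1 - s ^ 2 := by nlinarith [sq_abs s, abs_nonneg s]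
      rw [intervalIntegral.integral_of_le (by linarith [Real.sqrt_nonneg (1 - s ^ 2)]),
        integral_Ioc_eq_integral_Ioo, ← integral_indicator measurableSet_Ioo]
      refine integral_congr_ae (Eventually.of_forall fun t => ?_)
      have hiff : (⟨s, t⟩ : ℂ) ∈ ball (0 : ℂ) 1 ↔ t ∈ Ioo (-√(1 - s ^ 2)) √(1 - s ^ 2) := by
        rw [mk_mem_ball_iff, mem_Ioo, ← abs_lt, Real.lt_sqrt (abs_nonneg t), sq_abs]
        constructor <;> intro h <;> linarith
      simp only
      by_cases ht : t ∈ Ioo (-√(1 - s ^ 2)) √(1 - s ^ 2)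
      · rw [indicator_of_mem ht, indicator_of_mem (hiff.2 ht)]
      · rw [indicator_of_notMem ht, indicator_of_notMem (mt hiff.1 ht)]
    · refine (integral_congr_ae (Eventually.of_forall fun t => ?_)).trans (integral_zero _ _)
      rw [indicator_of_notMem]
      rw [mk_mem_ball_iff]
      have : 1 ≤ s ^ 2 := by rw [← sq_abs]; nlinarith
      nlinarith [sq_nonneg t]
  · have h := (integrable_indicator_iff measurableSet_ball).2 hF
    exact (e.integrable_comp_emb
      Complex.measurableEquivRealProd.symm.measurableEmbedding).2 h

/-- Cauchy's mean value on each circle of radius `ρ`, integrated against `ρ dρ` on `(0, 1)`. -/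
lemma setIntegral_disc_eq_pi_smul {g : ℂ → ℂ} {U : Set ℂ} (hU : IsOpen U)
    (hg : DifferentiableOn ℂ g U) (hsub : closedBall 0 1 ⊆ U) :
    ∫ w in ball (0 : ℂ) 1, g w = Real.pi * g 0 := by
  have hcirc : ∀ ρ ∈ Ioo (0 : ℝ) 1,
      ∫ θ in Ioo (-Real.pi) Real.pi, g (Complex.polarCoord.symm (ρ, θ)) =
        2 * Real.pi * g 0 := by
    intro ρ hρ
    have h1 : Real.circleAverage g 0 ρ = g 0 := by
      refine circleAverage_of_differentiable_on_off_countable countable_empty ?_ ?_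
      · rw [abs_of_pos hρ.1]
        exact hg.continuousOn.mono ((closedBall_subset_closedBall hρ.2.le).trans hsub)
      · rintro z ⟨hz, -⟩
        rw [abs_of_pos hρ.1] at hz
        exact hg.differentiableAt (hU.mem_nhds
          (hsub (ball_subset_closedBall.trans (closedBall_subset_closedBall hρ.2.le) hz)))
    -- The base angle is moved from `0` to `-π` to match the range of the polar coordinates.
    rw [Real.circleAverage_eq_integral_add (-Real.pi),
      intervalIntegral.integral_comp_add_right (fun θ => g (circleMap 0 ρ θ)),
      intervalIntegral.integral_of_le (by linarith [Real.pi_pos]),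
      integral_Ioc_eq_integral_Ioo] at h1
    have e : ∀ θ : ℝ, Complex.polarCoord.symm (ρ, θ) = circleMap 0 ρ θ := fun θ => by
      rw [Complex.polarCoord_symm_apply, circleMap, Complex.exp_mul_I, zero_add,
        Complex.ofReal_cos, Complex.ofReal_sin]
    simp_rw [e]
    have hpi : (2 * Real.pi : ℝ) ≠ 0 := by positivity
    rw [inv_smul_eq_iff₀ hpi, zero_add, two_mul, add_neg_cancel_right] at h1
    rw [h1, Complex.real_smul]
    push_cast
    ring
  have hT : Ioo (0 : ℝ) 1 ×ˢ Ioo (-Real.pi) Real.pi ⊆ polarCoord.target := by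
    rw [polarCoord_target]
    exact prod_mono Ioo_subset_Ioi_self subset_rfl
  have hcont : Continuous fun p : ℝ × ℝ => Complex.polarCoord.symm p := by
    simp only [Complex.polarCoord_symm_apply]
    fun_prop
  have hint : IntegrableOn (fun p : ℝ × ℝ => p.1 • g (Complex.polarCoord.symm p))
      (Ioo (0 : ℝ) 1 ×ˢ Ioo (-Real.pi) Real.pi) (volume.prod volume) := by
    have hK : IsCompact (Icc (0 : ℝ) 1 ×ˢ Icc (-Real.pi) Real.pi) := isCompact_Icc.prod isCompact_Icc
    refine IntegrableOn.mono_set (ContinuousOn.integrableOn_compact hK ?_)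
      (prod_mono Ioo_subset_Icc_self Ioo_subset_Icc_self)
    refine continuous_fst.continuousOn.smul (hg.continuousOn.comp hcont.continuousOn ?_)
    rintro p ⟨hp, -⟩
    apply hsub
    rw [mem_closedBall_zero_iff, Complex.norm_polarCoord_symm, abs_of_nonneg hp.1]
    exact hp.2
  rw [← integral_indicator measurableSet_ball, ← Complex.integral_comp_polarCoord_symm]
  have hind : ∫ p in polarCoord.target,
      p.1 • (ball (0 : ℂ) 1).indicator g (Complex.polarCoord.symm p) =
      ∫ p in Ioo (0 : ℝ) 1 ×ˢ Ioo (-Real.pi) Real.pi, p.1 • g (Complex.polarCoord.symm p) := by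
    rw [← integral_indicator polarCoord.open_target.measurableSet,
      ← integral_indicator (measurableSet_Ioo.prod measurableSet_Ioo)]
    refine integral_congr_ae (Eventually.of_forall fun p => ?_)
    by_cases hp : p ∈ Ioo (0 : ℝ) 1 ×ˢ Ioo (-Real.pi) Real.pi
    · rw [indicator_of_mem hp, indicator_of_mem (hT hp), indicator_of_mem]
      rw [mem_ball_zero_iff, Complex.norm_polarCoord_symm, abs_of_pos hp.1.1]
      exact hp.1.2
    · rw [indicator_of_notMem hp]
      by_cases hp' : p ∈ polarCoord.target
      · rw [indicator_of_mem hp', indicator_of_notMem, smul_zero]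
        rw [mem_ball_zero_iff, Complex.norm_polarCoord_symm]
        intro h
        exact hp ⟨⟨hp'.1, (le_abs_self _).trans_lt h⟩, hp'.2⟩
      · rw [indicator_of_notMem hp']
  rw [hind, Measure.volume_eq_prod, setIntegral_prod _ hint]
  have e2 : ∀ ρ ∈ Ioo (0 : ℝ) 1,
      ∫ θ in Ioo (-Real.pi) Real.pi, (ρ, θ).1 • g (Complex.polarCoord.symm (ρ, θ)) =
        ρ • (2 * Real.pi * g 0) := fun ρ hρ => by
    rw [← hcirc ρ hρ, ← integral_smul]
  rw [setIntegral_congr_fun measurableSet_Ioo e2, integral_smul_const,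
    ← integral_Ioc_eq_integral_Ioo, ← intervalIntegral.integral_of_le zero_le_one, integral_id,
    Complex.real_smul]
  push_cast
  ring

lemma integral_comp_planeProj {h : ℂ → ℝ} (hh : ContinuousOn h (closedBall 0 1)) :
    ∫ x, h (planeProj x) ∂sigma = Real.pi⁻¹ * ∫ w in ball (0 : ℂ) 1, h w := by
  have hV : (volume (ball (0 : ℂ) 1))⁻¹.toReal = Real.pi⁻¹ := by
    rw [Complex.volume_ball]; simp
  have hs : AEStronglyMeasurable h (volume.restrict (ball (0 : ℂ) 1)) :=
    (hh.mono ball_subset_closedBall).aestronglyMeasurable measurableSet_ball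
  rw [← integral_map (φ := planeProj) continuous_planeProj.measurable.aemeasurable,
    map_planeProj_sigma, integral_smul_measure, hV, smul_eq_mul]
  rw [map_planeProj_sigma]
  exact hs.smul_measure _

/-! ### The mean value property of spherical derivatives -/

/-- The point of the closed upper half plane that represents the sphere through `q`. -/
def halfPlane (q : ℍ) : ℂ := ⟨q.re, ‖q.im‖⟩

@[simp] lemma halfPlane_re (q : ℍ) : (halfPlane q).re = q.re := rfl

@[simp] lemma halfPlane_im (q : ℍ) : (halfPlane q).im = ‖q.im‖ := rfl

lemma continuous_halfPlane : Continuous halfPlane :=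
  Complex.equivRealProdCLM.symm.continuous.comp
    (Quaternion.continuous_re.prodMk Quaternion.continuous_im.norm)

lemma norm_im_eq_sqrt (q : ℍ) : ‖q.im‖ = √(q.imI ^ 2 + q.imJ ^ 2 + q.imK ^ 2) := by
  rw [← Real.sqrt_sq (norm_nonneg q.im), norm_sq_eq_sum_sq]
  simp

/-- The image in the half plane of a point of the sphere of radius `r` about `b₀ + iβ₀`, in terms
of the projection of the point to the first two coordinates. -/
def sphereHalfPlane (b₀ β₀ r : ℝ) (w : ℂ) : ℂ :=
  ⟨b₀ + r * w.re, √(β₀ ^ 2 + r ^ 2 * (1 - w.re ^ 2) + 2 * β₀ * r * w.im)⟩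

lemma continuous_sphereHalfPlane (b₀ β₀ r : ℝ) : Continuous (sphereHalfPlane b₀ β₀ r) := by
  refine Complex.equivRealProdCLM.symm.continuous.comp (Continuous.prodMk ?_ ?_)
  · exact continuous_const.add (continuous_const.mul Complex.continuous_re)
  · have := Complex.continuous_re
    have := Complex.continuous_im
    fun_prop

/-- On the unit sphere the squares of the three imaginary coordinates sum to `1 - re²`, so the last
two coordinates drop out. -/
lemma halfPlane_add_smul (b₀ β₀ r : ℝ) (x : Sphere3) :
    halfPlane (quat b₀ β₀ 0 0 + r • (x : ℍ)) = sphereHalfPlane b₀ β₀ r (planeProj x) := by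
  have hx := sum_sq_sphere x
  apply Complex.ext
  · simp [sphereHalfPlane, planeProj]
  · rw [halfPlane_im, norm_im_eq_sqrt]
    simp only [sphereHalfPlane, planeProj]
    congr 1
    simp only [Quaternion.imI_add, Quaternion.imI_smul, Quaternion.imJ_add, Quaternion.imJ_smul,
      Quaternion.imK_add, Quaternion.imK_smul, quat_imI, quat_imJ, quat_imK, smul_eq_mul]
    linear_combination r ^ 2 * hx

lemma exists_planeProj_eq {w : ℂ} (hw : w ∈ closedBall (0 : ℂ) 1) :
    ∃ x : Sphere3, planeProj x = w := by
  have h : w.re ^ 2 + w.im ^ 2 ≤ 1 := (mk_mem_closedBall_iff w.re w.im).1 hw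
  refine ⟨⟨quat w.re w.im √(1 - w.re ^ 2 - w.im ^ 2) 0, ?_⟩, rfl⟩
  rw [mem_sphere_zero_iff_norm, ← sq_eq_sq₀ (norm_nonneg _) zero_le_one, norm_sq_eq_sum_sq]
  simp only [quat_re, quat_imI, quat_imJ, quat_imK]
  rw [Real.sq_sqrt (by linarith)]
  ring

lemma smul_sphere_mem_closedBall {r : ℝ} (hr : 0 ≤ r) (b : ℍ) (x : Sphere3) :
    b + r • (x : ℍ) ∈ closedBall b r := by
  rw [mem_closedBall, dist_eq_norm, add_sub_cancel_left, norm_smul, norm_eq_of_mem_sphere,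
    mul_one, Real.norm_eq_abs, abs_of_nonneg hr]

/-- The squared height over the chord is affine in `t`, with slope `2β₀r`; the square `(β₀ + rt)²`
has derivative `2(β₀ + rt)r`. Because `κ² = 1 - s²`, both take the same values at `t = ±κ`.
Comparing the two substitutions yields the weight `(β₀ + rt)/β₀`, which turns `e` into `β₀⁻¹ Im ψ`.
-/
lemma intervalIntegral_sphereHalfPlane {U : Set ℂ} {ψ : ℂ → ℂ} {e : ℂ → ℝ} {b₀ β₀ r s κ : ℝ}
    (hβ : 0 < β₀) (hr : 0 < r) (hκ : κ ^ 2 = 1 - s ^ 2)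
    (he : ContinuousOn e U)
    (hpt : ∀ t ∈ uIcc (-κ) κ, (⟨b₀ + r * s, |β₀ + r * t|⟩ : ℂ) ∈ U)
    (heψ : ∀ t ∈ uIcc (-κ) κ, e ⟨b₀ + r * s, |β₀ + r * t|⟩ * (β₀ + r * t) =
      (ψ ⟨b₀ + r * s, β₀ + r * t⟩).im) :
    ∫ t in -κ..κ, e (sphereHalfPlane b₀ β₀ r ⟨s, t⟩) =
      ∫ t in -κ..κ, β₀⁻¹ * (ψ ⟨b₀ + r * s, β₀ + r * t⟩).im := by
  set G : ℝ → ℝ := fun u => e ⟨b₀ + r * s, √u⟩ with hG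
  have hc : 2 * β₀ * r ≠ 0 := by positivity
  have h1 : ∫ t in -κ..κ, e (sphereHalfPlane b₀ β₀ r ⟨s, t⟩) =
      (2 * β₀ * r)⁻¹ • ∫ u in (β₀ + r * (-κ)) ^ 2..(β₀ + r * κ) ^ 2, G u := by
    have := intervalIntegral.integral_comp_add_mul (a := -κ) (b := κ) G hc
      (β₀ ^ 2 + r ^ 2 * (1 - s ^ 2))
    rw [show β₀ ^ 2 + r ^ 2 * (1 - s ^ 2) + 2 * β₀ * r * (-κ) = (β₀ + r * (-κ)) ^ 2 by
      rw [← hκ]; ring, show β₀ ^ 2 + r ^ 2 * (1 - s ^ 2) + 2 * β₀ * r * κ = (β₀ + r * κ) ^ 2 by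
      rw [← hκ]; ring] at this
    exact this
  have h2 := intervalIntegral.integral_comp_mul_deriv'' (a := -κ) (b := κ)
    (f := fun t => (β₀ + r * t) ^ 2) (f' := fun t => 2 * (β₀ + r * t) * r) (g := G)
    (by fun_prop)
    (fun t _ => by
      exact (((((hasDerivAt_id' t).const_mul r).const_add β₀).fun_pow 2).congr_deriv
        (by push_cast; ring)).hasDerivWithinAt)
    (by fun_prop)
    (by
      refine he.comp (Continuous.continuousOn ?_) ?_
      · exact Complex.equivRealProdCLM.symm.continuous.comp
          (continuous_const.prodMk Real.continuous_sqrt)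
      · rintro u ⟨t, ht, rfl⟩
        simp only [Real.sqrt_sq_eq_abs]
        exact hpt t ht)
  rw [h1, ← h2, ← intervalIntegral.integral_smul]
  refine intervalIntegral.integral_congr fun t ht => ?_
  simp only [hG, Function.comp_apply, Real.sqrt_sq_eq_abs, ← heψ t ht, smul_eq_mul]
  field_simp

/-- The function `e` is `Im ψ / Im z`, extended continuously to the real points. The spherical mean
becomes a disc mean through `integral_comp_planeProj`; the chord identity makes it `β₀⁻¹` times the
imaginary part of the disc mean of `ψ`, that is `β₀⁻¹ Im ψ(b₀ + iβ₀)`. -/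
theorem mean_value_of_im_pos {U : Set ℂ} (hU : IsOpen U) (hconj : ∀ z ∈ U, star z ∈ U)
    {ψ : ℂ → ℂ} (hψ : DifferentiableOn ℂ ψ U) (hψc : ∀ z ∈ U, ψ (star z) = star (ψ z))
    {e : ℂ → ℝ} (he : ContinuousOn e U) (heψ : ∀ z ∈ U, e z * z.im = (ψ z).im)
    {b₀ β₀ r : ℝ} (hβ : 0 < β₀) (hr : 0 < r)
    (hball : ∀ q ∈ closedBall (quat b₀ β₀ 0 0) r, halfPlane q ∈ U) :
    ∫ x : Sphere3, e (halfPlane (quat b₀ β₀ 0 0 + r • (x : ℍ))) ∂sigma = e ⟨b₀, β₀⟩ := by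
  have hdisc : ∀ s t : ℝ, s ^ 2 + t ^ 2 ≤ 1 → (⟨b₀ + r * s, |β₀ + r * t|⟩ : ℂ) ∈ U := by
    intro s t hst
    have h := hball (quat (b₀ + r * s) (β₀ + r * t) 0 0) (by
      rw [mem_closedBall, dist_eq_norm, ← sq_le_sq₀ (norm_nonneg _) hr.le, norm_sq_eq_sum_sq]
      simp
      nlinarith [sq_nonneg r])
    have e1 : halfPlane (quat (b₀ + r * s) (β₀ + r * t) 0 0) = ⟨b₀ + r * s, |β₀ + r * t|⟩ := by
      apply Complex.ext
      · rfl
      · rw [halfPlane_im, norm_im_eq_sqrt]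
        simp [Real.sqrt_sq_eq_abs]
    rwa [e1] at h
  -- The planar disc may cross the real axis; below it, conjugation symmetry of `U` and of `ψ` is
  -- used, and the two sign changes cancel.
  have hdisc' : ∀ s t : ℝ, s ^ 2 + t ^ 2 ≤ 1 → (⟨b₀ + r * s, β₀ + r * t⟩ : ℂ) ∈ U ∧
      e ⟨b₀ + r * s, |β₀ + r * t|⟩ * (β₀ + r * t) = (ψ ⟨b₀ + r * s, β₀ + r * t⟩).im := by
    intro s t hst
    have h := hdisc s t hst
    rcases le_total 0 (β₀ + r * t) with h0 | h0
    · rw [abs_of_nonneg h0] at h ⊢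
      exact ⟨h, heψ _ h⟩
    · rw [abs_of_nonpos h0] at h ⊢
      have e1 : star (⟨b₀ + r * s, -(β₀ + r * t)⟩ : ℂ) = ⟨b₀ + r * s, β₀ + r * t⟩ := by
        apply Complex.ext <;> simp
      have h1 := hconj _ h
      have h2 := hψc _ h
      rw [e1] at h1 h2
      refine ⟨h1, ?_⟩
      rw [h2]
      have h3 := heψ _ h
      simp only [Complex.star_def, Complex.conj_im]
      rw [← h3]
      ring
  have hcl : ∀ w ∈ closedBall (0 : ℂ) 1, sphereHalfPlane b₀ β₀ r w ∈ U := by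
    intro w hw
    obtain ⟨x, rfl⟩ := exists_planeProj_eq hw
    rw [← halfPlane_add_smul]
    exact hball _ (smul_sphere_mem_closedBall hr.le _ _)
  have hcont1 : ContinuousOn (fun w => e (sphereHalfPlane b₀ β₀ r w)) (closedBall 0 1) :=
    he.comp (continuous_sphereHalfPlane _ _ _).continuousOn hcl
  have haff : ∀ w : ℂ, (⟨b₀, β₀⟩ : ℂ) + r * w = ⟨b₀ + r * w.re, β₀ + r * w.im⟩ := fun w => by
    apply Complex.ext <;> simp
  have hmaps : ∀ w ∈ closedBall (0 : ℂ) 1, (⟨b₀, β₀⟩ : ℂ) + r * w ∈ U := by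
    intro w hw
    rw [haff]
    exact (hdisc' _ _ ((mk_mem_closedBall_iff w.re w.im).1 hw)).1
  set V : Set ℂ := (fun w : ℂ => (⟨b₀, β₀⟩ : ℂ) + r * w) ⁻¹' U with hV
  have hVo : IsOpen V := hU.preimage (by fun_prop)
  have hg : DifferentiableOn ℂ (fun w : ℂ => ψ ((⟨b₀, β₀⟩ : ℂ) + r * w)) V :=
    hψ.comp (by fun_prop) fun w hw => hw
  have harea := setIntegral_disc_eq_pi_smul hVo hg hmaps
  have hgc : ContinuousOn (fun w : ℂ => ψ ((⟨b₀, β₀⟩ : ℂ) + r * w)) (closedBall 0 1) :=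
    hg.continuousOn.mono hmaps
  have hgi : IntegrableOn (fun w : ℂ => ψ ((⟨b₀, β₀⟩ : ℂ) + r * w)) (ball 0 1) :=
    (hgc.integrableOn_compact (isCompact_closedBall _ _)).mono_set ball_subset_closedBall
  have him : IntegrableOn (fun w : ℂ => β₀⁻¹ * (ψ ((⟨b₀, β₀⟩ : ℂ) + r * w)).im) (ball 0 1) :=
    (Complex.imCLM.integrable_comp hgi).const_mul _
  have hkey : ∫ w in ball (0 : ℂ) 1, e (sphereHalfPlane b₀ β₀ r w) =
      ∫ w in ball (0 : ℂ) 1, β₀⁻¹ * (ψ ((⟨b₀, β₀⟩ : ℂ) + r * w)).im := by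
    rw [setIntegral_disc_eq_iterated ((hcont1.integrableOn_compact
      (isCompact_closedBall _ _)).mono_set ball_subset_closedBall),
      setIntegral_disc_eq_iterated him]
    congr 1
    funext s
    split_ifs with hs
    · have h0 : 0 < 1 - s ^ 2 := by nlinarith [sq_abs s, abs_nonneg s]
      have hle : ∀ t ∈ uIcc (-√(1 - s ^ 2)) √(1 - s ^ 2), s ^ 2 + t ^ 2 ≤ 1 := by
        intro t ht
        rw [uIcc_of_le (by linarith [Real.sqrt_nonneg (1 - s ^ 2)])] at ht
        nlinarith [Real.sq_sqrt h0.le, abs_le.2 ht, sq_abs t, abs_nonneg t]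
      simp only [haff]
      exact intervalIntegral_sphereHalfPlane hβ hr (Real.sq_sqrt h0.le) he
        (fun t ht => hdisc s t (hle t ht)) (fun t ht => (hdisc' s t (hle t ht)).2)
    · rfl
  have h0 := (hdisc' 0 0 (by norm_num)).1
  have h0' := (hdisc' 0 0 (by norm_num)).2
  simp only [mul_zero, add_zero, abs_of_pos hβ] at h0 h0'
  simp_rw [halfPlane_add_smul]
  rw [integral_comp_planeProj hcont1, hkey, integral_const_mul]
  have him2 : ∫ w in ball (0 : ℂ) 1, (ψ ((⟨b₀, β₀⟩ : ℂ) + r * w)).im =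
      (∫ w in ball (0 : ℂ) 1, ψ ((⟨b₀, β₀⟩ : ℂ) + r * w)).im :=
    Complex.imCLM.integral_comp_comm hgi
  rw [him2, harea, mul_zero, add_zero, Complex.im_ofReal_mul, ← h0']
  have := Real.pi_ne_zero
  field_simp

/-- The real part is the inner product with 1, and the norm of the imaginary part is then determined
by the norm. -/
lemma halfPlane_isometry {e : ℍ ≃ₗᵢ[ℝ] ℍ} (he : e 1 = 1) (q : ℍ) :
    halfPlane (e q) = halfPlane q := by
  have hre : (e q).re = q.re := by
    have h := e.inner_map_map q 1
    rw [he, Quaternion.inner_def, Quaternion.inner_def] at h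
    simpa using h
  have hn : ∀ p : ℍ, ‖p.im‖ ^ 2 = ‖p‖ ^ 2 - p.re ^ 2 := fun p => by
    rw [norm_sq_eq_sum_sq, norm_sq_eq_sum_sq]
    simp only [Quaternion.re_im, Quaternion.imI_im, Quaternion.imJ_im, Quaternion.imK_im]
    ring
  apply Complex.ext
  · exact hre
  · rw [halfPlane_im, halfPlane_im, ← sq_eq_sq₀ (norm_nonneg _) (norm_nonneg _), hn, hn, hre,
      e.norm_map]

/-- With `J` the unit of `b` and `I` the quaternion `i`, the reflection in the hyperplane orthogonal
to `J - I` sends `J` to `I`, and it fixes 1 because `J` and `I` are purely imaginary. -/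
lemma exists_isometry_to_plane {b : ℍ} (hb : b.im ≠ 0) :
    ∃ e : ℍ ≃ₗᵢ[ℝ] ℍ, e 1 = 1 ∧ e b = quat b.re ‖b.im‖ 0 0 := by
  have hn : ‖b.im‖ ≠ 0 := norm_ne_zero_iff.2 hb
  set J : ℍ := ‖b.im‖⁻¹ • b.im with hJ
  set I : ℍ := quat 0 1 0 0 with hI
  have hJn : ‖J‖ = 1 := by rw [hJ, norm_smul, norm_inv, norm_norm, inv_mul_cancel₀ hn]
  have hIn : ‖I‖ = 1 := by
    rw [← sq_eq_sq₀ (norm_nonneg _) zero_le_one, norm_sq_eq_sum_sq]; simp [hI]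
  have h1 : (Submodule.reflection (ℝ ∙ (J - I))ᗮ) (1 : ℍ) = 1 := by
    rw [Submodule.reflection_eq_self_iff, Submodule.mem_orthogonal_singleton_iff_inner_right,
      Quaternion.inner_def]
    simp [hJ, hI]
  have h2 := Submodule.reflection_sub (hJn.trans hIn.symm)
  refine ⟨Submodule.reflection (ℝ ∙ (J - I))ᗮ, h1, ?_⟩
  have hb' : b = b.re • (1 : ℍ) + ‖b.im‖ • J := by
    rw [hJ, smul_smul, mul_inv_cancel₀ hn, one_smul]
    ext <;> simp
  have hq : quat b.re ‖b.im‖ 0 0 = b.re • (1 : ℍ) + ‖b.im‖ • I := by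
    ext <;> simp [hI]
  rw [hq]
  conv_lhs => rw [hb']
  rw [map_add, map_smul, map_smul, h1, h2]

/-- For a non-real centre, a rotation fixing 1 reduces to `mean_value_of_im_pos`. A real centre,
where that argument would divide by `β₀ = 0`, is the limit of the centres `b + εI`. -/
theorem mean_value {U : Set ℂ} (hU : IsOpen U) (hconj : ∀ z ∈ U, star z ∈ U)
    {ψ : ℂ → ℂ} (hψ : DifferentiableOn ℂ ψ U) (hψc : ∀ z ∈ U, ψ (star z) = star (ψ z))
    {e : ℂ → ℝ} (he : ContinuousOn e U) (heψ : ∀ z ∈ U, e z * z.im = (ψ z).im)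
    {b : ℍ} {r : ℝ} (hr : 0 ≤ r) (hball : ∀ q ∈ closedBall b r, halfPlane q ∈ U) :
    ∫ x : Sphere3, e (halfPlane (b + r • (x : ℍ))) ∂sigma = e (halfPlane b) := by
  rcases hr.eq_or_lt with rfl | hr
  · simp
  have hpos : ∀ c : ℍ, c.im ≠ 0 → (∀ q ∈ closedBall c r, halfPlane q ∈ U) →
      ∫ x : Sphere3, e (halfPlane (c + r • (x : ℍ))) ∂sigma = e (halfPlane c) := by
    intro c hc hball
    obtain ⟨R, hR1, hRc⟩ := exists_isometry_to_plane hc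
    have h := mean_value_of_im_pos hU hconj hψ hψc he heψ (b₀ := c.re) (β₀ := ‖c.im‖)
      (norm_pos_iff.2 hc) hr (by
        intro q hq
        rw [← hRc] at hq
        rw [← R.apply_symm_apply q, halfPlane_isometry hR1]
        apply hball
        rw [mem_closedBall] at hq ⊢
        rwa [← R.dist_map, R.apply_symm_apply])
    have hemb : MeasurableEmbedding (sphereIsometry R) :=
      (sphereIsometry R).toHomeomorph.measurableEmbedding
    rw [← hRc, ← map_sigma_isometryEquiv (sphereIsometry R), hemb.integral_map] at h
    refine Eq.trans ?_ h
    refine integral_congr_ae (Eventually.of_forall fun x => ?_)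
    change _ = e (halfPlane (R c + r • (R x)))
    rw [← map_smul, ← map_add, halfPlane_isometry hR1]
  by_cases hb : b.im = 0
  · have hO : IsOpen (halfPlane ⁻¹' U) := hU.preimage continuous_halfPlane
    have hE : ContinuousOn (fun q => e (halfPlane q)) (halfPlane ⁻¹' U) :=
      he.comp continuous_halfPlane.continuousOn fun q hq => hq
    -- Compactness leaves a margin `δ`: the balls about `b + εI` with `ε ≤ δ` stay in the domain,
    -- and one bound for `e` on the thickening serves as the dominating constant.
    obtain ⟨δ, hδ, hsub⟩ := (isCompact_closedBall b r).exists_cthickening_subset_open hO hball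
    obtain ⟨C, hC⟩ := ((isCompact_closedBall b r).cthickening (r := δ)).exists_bound_of_continuousOn
      (hE.mono hsub)
    set I : ℍ := quat 0 1 0 0 with hI
    have hIn : ‖I‖ = 1 := by
      rw [← sq_eq_sq₀ (norm_nonneg _) zero_le_one, norm_sq_eq_sum_sq]; simp [hI]
    have hmem : ∀ ε ∈ Icc 0 δ, ∀ q ∈ closedBall (b + ε • I) r, q ∈ cthickening δ (closedBall b r) := by
      intro ε hε q hq
      refine mem_cthickening_of_dist_le q (q - ε • I) _ _ ?_ ?_
      · rw [mem_closedBall, dist_eq_norm] at hq ⊢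
        rwa [sub_sub, add_comm (ε • I)]
      · rw [dist_eq_norm, sub_sub_cancel, norm_smul, hIn, mul_one, Real.norm_eq_abs,
          abs_of_nonneg hε.1]
        exact hε.2
    have hIoc : ∀ᶠ ε in 𝓝[>] (0 : ℝ), ε ∈ Ioc 0 δ := Ioc_mem_nhdsGT hδ
    have hlin : ∀ q : ℍ, Tendsto (fun ε : ℝ => q + ε • I) (𝓝[>] 0) (𝓝 q) := by
      intro q
      have : Continuous fun ε : ℝ => q + ε • I := by fun_prop
      have h := this.tendsto 0
      rw [zero_smul, add_zero] at h
      exact h.mono_left nhdsWithin_le_nhds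
    have hbmem : ∀ q ∈ closedBall b r, Tendsto (fun ε : ℝ => e (halfPlane (q + ε • I)))
        (𝓝[>] 0) (𝓝 (e (halfPlane q))) := fun q hq =>
      Tendsto.comp (g := fun q => e (halfPlane q)) (hE.continuousAt (hO.mem_nhds (hball q hq)))
        (hlin q)
    have hlim : Tendsto (fun ε : ℝ => ∫ x : Sphere3, e (halfPlane (b + ε • I + r • (x : ℍ))) ∂sigma)
        (𝓝[>] 0) (𝓝 (∫ x : Sphere3, e (halfPlane (b + r • (x : ℍ))) ∂sigma)) := by
      refine tendsto_integral_filter_of_dominated_convergence (fun _ => C) ?_ ?_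
        (integrable_const C) ?_
      · filter_upwards [hIoc] with ε hε
        refine Continuous.aestronglyMeasurable ?_
        refine hE.comp_continuous (by fun_prop) fun x => ?_
        exact hsub (hmem ε ⟨hε.1.le, hε.2⟩ _ (smul_sphere_mem_closedBall hr.le _ x))
      · filter_upwards [hIoc] with ε hε
        refine Eventually.of_forall fun x => ?_
        exact hC _ (hmem ε ⟨hε.1.le, hε.2⟩ _ (smul_sphere_mem_closedBall hr.le _ x))
      · refine Eventually.of_forall fun x => ?_
        have h := hbmem (b + r • (x : ℍ)) (smul_sphere_mem_closedBall hr.le b x)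
        simpa only [add_right_comm] using h
    have hlim2 := hbmem b (mem_closedBall_self hr.le)
    refine tendsto_nhds_unique hlim (hlim2.congr' ?_)
    filter_upwards [hIoc] with ε hε
    refine (hpos _ ?_ fun q hq => hsub (hmem ε ⟨hε.1.le, hε.2⟩ q hq)).symm
    intro h0
    have h1 := congrArg (fun q : ℍ => q.imI) h0
    have h2 := congrArg (fun q : ℍ => q.imI) hb
    simp [hI] at h1 h2
    linarith [hε.1]
  · exact hpos b hb hball

lemma integral_quat_mul {X : Type*} [MeasurableSpace X] {μ : Measure X} {g : X → ℍ}
    (hg : Integrable g μ) (q : ℍ) : ∫ x, q * g x ∂μ = q * ∫ x, g x ∂μ :=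
  (ContinuousLinearMap.mul ℝ ℍ q).integral_comp_comm hg

/-- **Mean value formula in one variable**, for the slice function with stem function `A + eB` and
spherical derivative `S`. -/
theorem slice_mean_value {U : Set ℂ} (hU : IsOpen U) (hconj : ∀ z ∈ U, star z ∈ U)
    {A B S : ℂ → ℍ} (hA : ∀ z ∈ U, A (star z) = A z) (hB : ∀ z ∈ U, B (star z) = -B z)
    (hol : ∀ c : ℍ →L[ℝ] ℝ, DifferentiableOn ℂ (fun z => (⟨c (A z), c (B z)⟩ : ℂ)) U)
    (hAc : ContinuousOn A U) (hS : ContinuousOn S U) (hSB : ∀ z ∈ U, z.im • S z = B z)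
    {b : ℍ} {r : ℝ} (hr : 0 ≤ r) (hball : ∀ q ∈ closedBall b r, halfPlane q ∈ U) :
    A (halfPlane b) + b.im * S (halfPlane b) =
      (∫ x : Sphere3, (A (halfPlane (b + r • (x : ℍ))) +
        (b + r • (x : ℍ)).im * S (halfPlane (b + r • (x : ℍ)))) ∂sigma) +
      r • ∫ x : Sphere3, star (x : ℍ) * S (halfPlane (b + r • (x : ℍ))) ∂sigma := by
  have hmem : ∀ x : Sphere3, halfPlane (b + r • (x : ℍ)) ∈ U := fun x =>
    hball _ (smul_sphere_mem_closedBall hr b x)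
  have hbU : halfPlane b ∈ U := hball b (mem_closedBall_self hr)
  have hh : Continuous fun x : Sphere3 => halfPlane (b + r • (x : ℍ)) :=
    continuous_halfPlane.comp (by fun_prop)
  have hSx : Continuous fun x : Sphere3 => S (halfPlane (b + r • (x : ℍ))) :=
    hS.comp_continuous hh hmem
  have hAx : Continuous fun x : Sphere3 => A (halfPlane (b + r • (x : ℍ))) :=
    hAc.comp_continuous hh hmem
  have hint : ∀ {g : Sphere3 → ℍ}, Continuous g → Integrable g sigma := fun {g} hg =>
    hg.integrable_of_hasCompactSupport (HasCompactSupport.of_compactSpace g)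
  -- Up to the factor `Im z`, this is the imaginary part of `(z - re b)(A + iB)`, so it also has the
  -- mean value property; at the centre it reduces to `A`.
  set T : ℂ → ℍ := fun z => A z + (z.re - b.re) • S z with hT
  have hTc : ContinuousOn T U :=
    hAc.add (((Complex.continuous_re.sub continuous_const).continuousOn).smul hS)
  have hTx : Continuous fun x : Sphere3 => T (halfPlane (b + r • (x : ℍ))) :=
    hTc.comp_continuous hh hmem
  -- Quaternion-valued means are tested against real linear functionals, since `mean_value` is
  -- scalar.
  have hvec : ∀ {G : ℂ → ℍ}, ContinuousOn G U → (∀ c : ℍ →L[ℝ] ℝ,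
      ∫ x : Sphere3, c (G (halfPlane (b + r • (x : ℍ)))) ∂sigma = c (G (halfPlane b))) →
      ∫ x : Sphere3, G (halfPlane (b + r • (x : ℍ))) ∂sigma = G (halfPlane b) := by
    intro G hG h
    refine (SeparatingDual.eq_iff_forall_dual_eq (R := ℝ)).2 fun c => ?_
    rw [← h c]
    exact (c.integral_comp_comm (hint (hG.comp_continuous hh hmem))).symm
  have hmkc : ∀ c : ℍ →L[ℝ] ℝ, ∀ z ∈ U, (⟨c (A (star z)), c (B (star z))⟩ : ℂ) =
      star (⟨c (A z), c (B z)⟩ : ℂ) := by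
    intro c z hz
    rw [hA z hz, hB z hz]
    apply Complex.ext <;> simp
  have hSmean : ∫ x : Sphere3, S (halfPlane (b + r • (x : ℍ))) ∂sigma = S (halfPlane b) := by
    refine hvec hS fun c => ?_
    refine mean_value (e := fun z => c (S z)) hU hconj (hol c) (hmkc c)
      (c.continuous.comp_continuousOn hS) (fun z hz => ?_) hr hball
    simp only
    rw [← hSB z hz, map_smul, smul_eq_mul, mul_comm]
  have hTmean : ∫ x : Sphere3, T (halfPlane (b + r • (x : ℍ))) ∂sigma = T (halfPlane b) := by
    refine hvec hTc fun c => ?_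
    refine mean_value (e := fun z => c (T z))
      (ψ := fun z => (z - b.re) * (⟨c (A z), c (B z)⟩ : ℂ)) hU hconj
      ((differentiableOn_id.sub_const _).mul (hol c)) (fun z hz => ?_)
      (c.continuous.comp_continuousOn hTc) (fun z hz => ?_) hr hball
    · rw [hmkc c z hz, star_mul', star_sub]
      simp
    · simp only [hT, Complex.mul_im, map_add, map_smul, smul_eq_mul, ← hSB z hz]
      simp
      ring
  have hTb : T (halfPlane b) = A (halfPlane b) := by
    simp [hT]
  have hpt : ∀ x : Sphere3, (A (halfPlane (b + r • (x : ℍ))) +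
      (b + r • (x : ℍ)).im * S (halfPlane (b + r • (x : ℍ)))) +
      r • (star (x : ℍ) * S (halfPlane (b + r • (x : ℍ)))) =
      T (halfPlane (b + r • (x : ℍ))) + b.im * S (halfPlane (b + r • (x : ℍ))) := by
    intro x
    -- The reason for the weight `λ̄`: it cancels the imaginary part of `rλ` and leaves a real
    -- scalar plus the constant `im b`.
    have e1 : (b + r • (x : ℍ)).im + r • star (x : ℍ) =
        (((b + r • (x : ℍ)).re - b.re : ℝ) : ℍ) + b.im := by
      ext <;> simp
    simp only [hT, halfPlane_re]
    rw [add_assoc, ← smul_mul_assoc, ← add_mul, e1, add_mul, Quaternion.coe_mul_eq_smul,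
      ← add_assoc]
  have him : Continuous fun x : Sphere3 => (b + r • (x : ℍ)).im :=
    Quaternion.continuous_im.comp (by fun_prop)
  have hst : Continuous fun x : Sphere3 => star (x : ℍ) := by fun_prop
  have h1 : Continuous fun x : Sphere3 => A (halfPlane (b + r • (x : ℍ))) +
      (b + r • (x : ℍ)).im * S (halfPlane (b + r • (x : ℍ))) := hAx.add (him.mul hSx)
  have h2 : Continuous fun x : Sphere3 => r • (star (x : ℍ) * S (halfPlane (b + r • (x : ℍ)))) :=
    (hst.mul hSx).const_smul r
  have h3 : Continuous fun x : Sphere3 => b.im * S (halfPlane (b + r • (x : ℍ))) :=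
    continuous_const.mul hSx
  rw [← integral_smul, ← integral_add (hint h1) (hint h2)]
  simp_rw [hpt]
  rw [integral_add (hint hTx) (hint h3), hTmean, hTb, integral_quat_mul (hint hSx), hSmean]

/-! ### Stem functions holomorphic in some of the variables -/

open Function

/-- The complex-valued function `c(G_K) + i c(G_{K ∪ h})`. -/
def stemPair {n : ℕ} (c : ℍ →L[ℝ] ℝ) (G : (Fin n → ℂ) → StemSpace n) (h : Fin n)
    (K : Finset (Fin n)) (z : Fin n → ℂ) : ℂ :=
  ⟨c (G z K), c (G z (insert h K))⟩

/-- A continuous stem function on `D` that is holomorphic in each of the variables in `S`. -/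
structure IsHolomorphicIn {n : ℕ} (D : Set (Fin n → ℂ)) (S : Set (Fin n))
    (G : (Fin n → ℂ) → StemSpace n) : Prop where
  isStem : IsStem D G
  continuousOn : ContinuousOn G D
  differentiableAt : ∀ h ∈ S, ∀ K, h ∉ K → ∀ c : ℍ →L[ℝ] ℝ, ∀ z ∈ D,
    DifferentiableAt ℂ (fun w => stemPair c G h K (update z h w)) (z h)

/-- The `i`-th real coordinate of a quaternion. -/
def quatCoord (i : Fin 4) : ℍ →L[ℝ] ℝ :=
  (EuclideanSpace.proj i : EuclideanSpace ℝ (Fin 4) →L[ℝ] ℝ).comp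
    (Quaternion.linearIsometryEquivTuple.toContinuousLinearEquiv : ℍ →L[ℝ] EuclideanSpace ℝ (Fin 4))

lemma continuousAt_of_forall_dual {X : Type*} [TopologicalSpace X] {f : X → ℍ} {x : X}
    (hf : ∀ c : ℍ →L[ℝ] ℝ, ContinuousAt (fun y => c (f y)) x) : ContinuousAt f x := by
  rw [← Quaternion.linearIsometryEquivTuple.toHomeomorph.comp_continuousAt_iff,
    ← (PiLp.homeomorph 2 fun _ : Fin 4 => ℝ).comp_continuousAt_iff, continuousAt_pi]
  exact fun i => hf (quatCoord i)

lemma differentiableAt_of_forall_dual {E : Type*} [NormedAddCommGroup E] [NormedSpace ℝ E]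
    {f : E → ℍ} {x : E} (hf : ∀ c : ℍ →L[ℝ] ℝ, DifferentiableAt ℝ (fun y => c (f y)) x) :
    DifferentiableAt ℝ f x := by
  rw [← Quaternion.linearIsometryEquivTuple.comp_differentiableAt_iff, differentiableAt_euclidean]
  exact fun i => hf (quatCoord i)

lemma continuousAt_mk {X : Type*} [TopologicalSpace X] {f g : X → ℝ} {x : X}
    (hf : ContinuousAt f x) (hg : ContinuousAt g x) :
    ContinuousAt (fun y => (⟨f y, g y⟩ : ℂ)) x :=
  Complex.equivRealProdCLM.symm.continuous.continuousAt.comp (hf.prodMk hg)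

lemma complexStructure_apply {n : ℕ} (h : Fin n) (q : StemSpace n) (K : Finset (Fin n)) :
    complexStructure h q K =
      (-1 : ℝ) ^ (symmDiff K {h} ∩ {h}).card • q (symmDiff K {h}) := by
  rw [complexStructure, Finset.sum_apply, Finset.sum_eq_single (symmDiff K {h})]
  · rw [symmDiff_symmDiff_cancel_right, Pi.single_eq_same]
  · intro L _ hL
    rw [Pi.single_eq_of_ne]
    rintro rfl
    exact hL (symmDiff_symmDiff_cancel_right _ _).symm
  · simp

lemma update_mem_conj {n : ℕ} {D : Set (Fin n → ℂ)} {G : (Fin n → ℂ) → StemSpace n}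
    (hG : IsStem D G) {z : Fin n → ℂ} {h : Fin n} {w : ℂ} (hw : update z h w ∈ D) :
    update z h (star w) ∈ D := by
  have := hG.1 _ hw h
  rwa [conjAt, update_self, update_idem] at this

lemma stem_update_star {n : ℕ} {D : Set (Fin n → ℂ)} {G : (Fin n → ℂ) → StemSpace n}
    (hG : IsStem D G) {z : Fin n → ℂ} {h : Fin n} {w : ℂ} (hw : update z h w ∈ D)
    (K : Finset (Fin n)) :
    G (update z h (star w)) K = (-1 : ℝ) ^ (K ∩ {h}).card • G (update z h w) K := by
  have := hG.2 _ hw h K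
  rwa [conjAt, update_self, update_idem] at this

lemma isOpen_update_preimage {n : ℕ} {D : Set (Fin n → ℂ)} (hD : IsOpen D) (z : Fin n → ℂ)
    (h : Fin n) : IsOpen {w : ℂ | update z h w ∈ D} :=
  hD.preimage (continuous_const.update h continuous_id)

lemma stemPair_update_star {n : ℕ} {D : Set (Fin n → ℂ)} {G : (Fin n → ℂ) → StemSpace n}
    (hG : IsStem D G) (c : ℍ →L[ℝ] ℝ) {z : Fin n → ℂ} {h : Fin n} {K : Finset (Fin n)}
    (hK : h ∉ K) {w : ℂ} (hw : update z h w ∈ D) :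
    stemPair c G h K (update z h (star w)) = star (stemPair c G h K (update z h w)) := by
  have h1 : K ∩ {h} = ∅ := Finset.inter_singleton_of_notMem hK
  have h2 : insert h K ∩ {h} = {h} := by simp
  rw [stemPair, stemPair, stem_update_star hG hw, stem_update_star hG hw, h1, h2]
  apply Complex.ext <;> simp

lemma IsHolomorphicIn.differentiableOn {n : ℕ} {D : Set (Fin n → ℂ)} {S : Set (Fin n)}
    {G : (Fin n → ℂ) → StemSpace n} (hG : IsHolomorphicIn D S G) {h : Fin n} (hh : h ∈ S)
    {K : Finset (Fin n)} (hK : h ∉ K) (c : ℍ →L[ℝ] ℝ) (z : Fin n → ℂ) :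
    DifferentiableOn ℂ (fun w => stemPair c G h K (update z h w)) {w | update z h w ∈ D} := by
  intro w hw
  have := hG.differentiableAt h hh K hK c _ hw
  simp only [update_idem, update_self] at this
  exact this.differentiableWithinAt

lemma IsHolomorphicIn.continuousOn_stemPair {n : ℕ} {D : Set (Fin n → ℂ)} {S : Set (Fin n)}
    {G : (Fin n → ℂ) → StemSpace n} (hG : IsHolomorphicIn D S G) (hD : IsOpen D) (h : Fin n)
    (K : Finset (Fin n)) (c : ℍ →L[ℝ] ℝ) : ContinuousOn (stemPair c G h K) D := by
  intro z hz
  have hc : ∀ L, ContinuousAt (fun z => c (G z L)) z := fun L =>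
    c.continuous.continuousAt.comp
      (continuousAt_pi.1 (hG.continuousOn.continuousAt (hD.mem_nhds hz)) L)
  exact (continuousAt_mk (hc _) (hc _)).continuousWithinAt

/-- For `h ∉ K`, the components `K` and `K ∪ {h}` of `∂̄_h F = 0` are the two Cauchy–Riemann
equations of `F_K + i F_{K ∪ h}`. -/
lemma IsHolomorphicStem.isHolomorphicIn {n : ℕ} {D : Set (Fin n → ℂ)} (hD : IsOpen D)
    {F : (Fin n → ℂ) → StemSpace n} (hs : IsStem D F) (hF : IsHolomorphicStem D F) :
    IsHolomorphicIn D univ F := by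
  refine ⟨hs, hF.1.continuousOn, fun h _ K hK c z hz => ?_⟩
  have hdiff : DifferentiableAt ℝ F z :=
    (hF.1.differentiableOn one_ne_zero).differentiableAt (hD.mem_nhds hz)
  set L := fderiv ℝ F z with hL
  have hα : partialAlpha h F z = L (Pi.single h 1) := hdiff.lineDeriv_eq_fderiv
  have hβ : partialBeta h F z = L (Pi.single h Complex.I) := hdiff.lineDeriv_eq_fderiv
  have hcr : L (Pi.single h 1) + complexStructure h (L (Pi.single h Complex.I)) = 0 := by
    have := hF.2 h z hz
    rw [dbar, hα, hβ] at this
    exact (smul_eq_zero.1 this).resolve_left (by norm_num)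
  have hsd1 : symmDiff K {h} = insert h K := by
    ext i; by_cases hi : i = h
    · subst hi; simp [Finset.mem_symmDiff, hK]
    · simp [Finset.mem_symmDiff, hi]
  have hsd2 : symmDiff (insert h K) {h} = K := by
    ext i; by_cases hi : i = h
    · subst hi; simp [Finset.mem_symmDiff, hK]
    · simp [Finset.mem_symmDiff, hi]
  have h1 : L (Pi.single h 1) K = L (Pi.single h Complex.I) (insert h K) := by
    have := congrFun hcr K
    rw [Pi.add_apply, complexStructure_apply, hsd1] at this
    have e : insert h K ∩ {h} = {h} := by simp
    rw [e] at this
    simpa [add_neg_eq_zero] using this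
  have h2 : L (Pi.single h Complex.I) K = -L (Pi.single h 1) (insert h K) := by
    have := congrFun hcr (insert h K)
    rw [Pi.add_apply, complexStructure_apply, hsd2] at this
    have e : K ∩ {h} = ∅ := Finset.inter_singleton_of_notMem hK
    rw [e] at this
    rw [eq_neg_iff_add_eq_zero, add_comm]
    simpa using this
  have hz' : update z h (z h) = z := update_eq_self h z
  have hF1 : HasFDerivAt (fun w => F (update z h w))
      (L.comp (ContinuousLinearMap.pi (Pi.single h (ContinuousLinearMap.id ℝ ℂ)))) (z h) := by
    refine HasFDerivAt.comp (g := F) (z h) ?_ (hasFDerivAt_update z (z h))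
    rw [hz']
    exact hdiff.hasFDerivAt
  have hcomp : ∀ J, HasFDerivAt (fun w => c (F (update z h w) J))
      (c.comp ((ContinuousLinearMap.proj J).comp
        (L.comp (ContinuousLinearMap.pi (Pi.single h (ContinuousLinearMap.id ℝ ℂ)))))) (z h) :=
    fun J => c.hasFDerivAt.comp (z h) ((hasFDerivAt_pi'.1 hF1) J)
  have hpair := Complex.equivRealProdCLM.symm.toContinuousLinearMap.hasFDerivAt.comp (z h)
    ((hcomp K).prodMk (hcomp (insert h K)))
  have hsingle : ∀ v : ℂ, (fun i => (Pi.single h (ContinuousLinearMap.id ℝ ℂ) :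
      ∀ _ : Fin n, ℂ →L[ℝ] ℂ) i v) = Pi.single h v := by
    intro v
    funext i
    by_cases hi : i = h
    · subst hi; simp
    · simp [hi]
  rw [differentiableAt_complex_iff_differentiableAt_real]
  refine ⟨hpair.differentiableAt, ?_⟩
  have hval : ∀ v : ℂ, fderiv ℝ (fun w => stemPair c F h K (update z h w)) (z h) v =
      ⟨c (L (Pi.single h v) K), c (L (Pi.single h v) (insert h K))⟩ := by
    intro v
    have := congrArg (fun M : ℂ →L[ℝ] ℂ => M v) hpair.fderiv
    refine this.trans ?_
    rw [← hsingle v]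
    rfl
  rw [hval, hval, h1, h2]
  apply Complex.ext <;> simp

/-! ### Spherical derivatives as Cauchy integrals: continuity and holomorphy across the real points
-/

/-- The Cauchy kernel of the divided difference `(φ(z) - φ(z̄)) / (z - z̄)`. -/
def symmCauchy (φ : ℂ → ℂ) (x : ℂ) (R : ℝ) (z : ℂ) : ℂ :=
  (2 * Real.pi * Complex.I)⁻¹ • ∮ ζ in C(x, R), ((ζ - z) * (ζ - star z))⁻¹ • φ ζ

lemma star_mem_ball {x z : ℂ} (hx : x.im = 0) {R : ℝ} (hz : z ∈ ball x R) :
    star z ∈ ball x R := by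
  have hxs : star x = x := by apply Complex.ext <;> simp [hx]
  rw [mem_ball, ← hxs, dist_star_star]
  exact hz

/-- Partial fractions and Cauchy's formula at `z` and `z̄`, both inside the circle since its centre
is real; then `φ(z) - φ(z̄) = 2i Im φ(z)`. -/
lemma symmCauchy_of_im_ne_zero {U : Set ℂ} {φ : ℂ → ℂ}
    (hφ : DifferentiableOn ℂ φ U) (hφc : ∀ z ∈ U, φ (star z) = star (φ z)) {x : ℂ}
    (hx : x.im = 0) {R : ℝ} (hsub : closedBall x R ⊆ U) {z : ℂ} (hz : z ∈ ball x R)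
    (him : z.im ≠ 0) : symmCauchy φ x R z = ((φ z).im / z.im : ℝ) := by
  have hz' := star_mem_ball hx hz
  have hR : 0 < R := pos_of_mem_ball hz
  have hd : DifferentiableOn ℂ φ (closedBall x R) := hφ.mono hsub
  have hne : z - star z ≠ 0 := by
    intro h
    have := congrArg Complex.im h
    simp at this
    exact him this
  have hsph : ∀ p ∈ ball x R, ∀ ζ ∈ sphere x R, ζ - p ≠ 0 := by
    intro p hp ζ hζ h
    rw [sub_eq_zero] at h
    rw [h] at hζ
    exact (ne_of_lt hp) hζ
  have hint : ∀ p ∈ ball x R, CircleIntegrable (fun ζ => (ζ - p)⁻¹ • φ ζ) x R := by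
    intro p hp
    refine ContinuousOn.circleIntegrable hR.le ?_
    refine ContinuousOn.smul (ContinuousOn.inv₀ (by fun_prop) fun ζ hζ => hsph p hp ζ hζ) ?_
    exact hd.continuousOn.mono sphere_subset_closedBall
  have hkey : ∮ ζ in C(x, R), ((ζ - z) * (ζ - star z))⁻¹ • φ ζ =
      (z - star z)⁻¹ • ((∮ ζ in C(x, R), (ζ - z)⁻¹ • φ ζ) -
        ∮ ζ in C(x, R), (ζ - star z)⁻¹ • φ ζ) := by
    rw [← circleIntegral.integral_sub (hint z hz) (hint _ hz'), ← circleIntegral.integral_smul]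
    refine circleIntegral.integral_congr hR.le fun ζ hζ => ?_
    have h1 := hsph z hz ζ hζ
    have h2 := hsph _ hz' ζ hζ
    simp only [smul_eq_mul]
    field_simp
    ring
  have hpi : (2 * Real.pi * Complex.I : ℂ) ≠ 0 := Complex.two_pi_I_ne_zero
  rw [symmCauchy, hkey, hd.circleIntegral_sub_inv_smul hz, hd.circleIntegral_sub_inv_smul hz',
    hφc z (hsub (ball_subset_closedBall hz)), smul_comm, ← smul_sub, inv_smul_smul₀ hpi,
    smul_eq_mul]
  have e : ∀ w : ℂ, w - star w = 2 * Complex.I * w.im := fun w => by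
    apply Complex.ext
    · simp
    · simp; ring
  have him' : (z.im : ℂ) ≠ 0 := Complex.ofReal_ne_zero.2 him
  rw [e, e]
  push_cast
  field_simp

/-- The two poles merge, and the integral becomes Cauchy's formula for the derivative. -/
lemma symmCauchy_of_im_eq_zero {U : Set ℂ} (hU : IsOpen U) {φ : ℂ → ℂ}
    (hφ : DifferentiableOn ℂ φ U) {x : ℂ} {R : ℝ} (hsub : closedBall x R ⊆ U) {z : ℂ}
    (hz : z ∈ ball x R) (him : z.im = 0) : symmCauchy φ x R z = deriv φ z := by
  have hzs : star z = z := by apply Complex.ext <;> simp [him]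
  rw [symmCauchy, hzs, ← Complex.two_pi_I_inv_smul_circleIntegral_sub_sq_inv_smul_of_differentiable
    hU hsub hφ hz]
  simp_rw [← sq]

lemma update_add_smul_single {n : ℕ} (z : Fin n → ℂ) (h : Fin n) (t : ℝ) :
    z + t • (Pi.single h Complex.I : Fin n → ℂ) = update z h (z h + t * Complex.I) := by
  funext i
  by_cases hi : i = h
  · subst hi; simp
  · simp [hi]

/-- Along the direction `i` a holomorphic `φ` has derivative `iφ'`, whose imaginary part is `Re φ'`.
-/
lemma IsHolomorphicIn.dual_partialBeta {n : ℕ} {D : Set (Fin n → ℂ)} {S : Set (Fin n)}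
    {G : (Fin n → ℂ) → StemSpace n} (hG : IsHolomorphicIn D S G)
    {h : Fin n} (hh : h ∈ S) {K : Finset (Fin n)} (hK : h ∉ K) (c : ℍ →L[ℝ] ℝ)
    {z : Fin n → ℂ} (hz : z ∈ D) :
    c (partialBeta h G z (insert h K)) =
      (deriv (fun w => stemPair c G h K (update z h w)) (z h)).re := by
  have hline : ∀ (c : ℍ →L[ℝ] ℝ) (K : Finset (Fin n)), h ∉ K →
      HasDerivAt (fun t : ℝ => stemPair c G h K (z + t • (Pi.single h Complex.I : Fin n → ℂ)))
        (deriv (fun w => stemPair c G h K (update z h w)) (z h) * Complex.I) 0 := by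
    intro c K hK
    have h1 := (hG.differentiableAt h hh K hK c z hz).hasDerivAt
    have h2 : HasDerivAt (fun t : ℝ => z h + t * Complex.I) Complex.I 0 := by
      simpa using ((Complex.ofRealCLM.hasDerivAt (x := 0)).mul_const Complex.I).const_add (z h)
    have e0 : z h = z h + ((0 : ℝ) : ℂ) * Complex.I := by simp
    rw [e0] at h1
    have h3 := HasDerivAt.comp (h₂ := fun w => stemPair c G h K (update z h w)) 0 h1 h2
    simp only [update_add_smul_single]
    rw [← e0] at h3
    exact h3
  -- `partialBeta` differentiates the whole vector of components and would take the default value 0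
  -- if one of them were not differentiable, so all of them are checked.
  have hline' : ∀ J, DifferentiableAt ℝ (fun t : ℝ => G (z + t • (Pi.single h Complex.I : Fin n → ℂ)) J) 0 := by
    intro J
    refine differentiableAt_of_forall_dual fun c => ?_
    by_cases hJ : h ∈ J
    · have := (hline c (J.erase h) (Finset.notMem_erase h J)).differentiableAt
      have h2 := (Complex.imCLM.differentiableAt (x := _)).comp (0 : ℝ) this
      rw [← Finset.insert_erase hJ]
      exact h2
    · have := (hline c J hJ).differentiableAt
      exact (Complex.reCLM.differentiableAt (x := _)).comp (0 : ℝ) this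
  have hdiff : DifferentiableAt ℝ (fun t : ℝ => G (z + t • (Pi.single h Complex.I : Fin n → ℂ))) 0 :=
    differentiableAt_pi.2 hline'
  have h1 : HasDerivAt (fun t : ℝ => c (G (z + t • (Pi.single h Complex.I : Fin n → ℂ)) (insert h K)))
      (c (partialBeta h G z (insert h K))) 0 :=
    c.hasFDerivAt.comp_hasDerivAt 0 ((hasDerivAt_pi.1 hdiff.hasDerivAt) (insert h K))
  have h2 : HasDerivAt (fun t : ℝ => c (G (z + t • (Pi.single h Complex.I : Fin n → ℂ)) (insert h K)))
      ((deriv (fun w => stemPair c G h K (update z h w)) (z h) * Complex.I).im) 0 :=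
    Complex.imCLM.hasFDerivAt.comp_hasDerivAt 0 (hline c K hK)
  rw [h1.unique h2]
  simp

/-- One integral over a fixed circle represents both branches in the definition of `sphDeriv`, so
the case distinction at `β_h = 0` disappears near a real point. -/
lemma IsHolomorphicIn.dual_sphDeriv {n : ℕ} {D : Set (Fin n → ℂ)} {S : Set (Fin n)}
    {G : (Fin n → ℂ) → StemSpace n} (hG : IsHolomorphicIn D S G) (hD : IsOpen D)
    {h : Fin n} (hh : h ∈ S) {K : Finset (Fin n)} (hK : h ∉ K) (c : ℍ →L[ℝ] ℝ)
    {z : Fin n → ℂ} {x : ℂ} (hx : x.im = 0) {R : ℝ} (hzx : z h ∈ ball x R)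
    (hsub : ∀ w ∈ closedBall x R, update z h w ∈ D) :
    c (sphDeriv h G z K) =
      (symmCauchy (fun w => stemPair c G h K (update z h w)) x R (z h)).re := by
  have hz : z ∈ D := by
    have := hsub (z h) (ball_subset_closedBall hzx)
    rwa [update_eq_self] at this
  by_cases him : (z h).im = 0
  · rw [symmCauchy_of_im_eq_zero (isOpen_update_preimage hD z h) (hG.differentiableOn hh hK c z)
      hsub hzx him, ← hG.dual_partialBeta hh hK c hz, sphDeriv, if_neg hK, if_pos him]
  · rw [symmCauchy_of_im_ne_zero (hG.differentiableOn hh hK c z)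
      (fun w hw => stemPair_update_star hG.isStem c hK hw) hx hsub hzx him, Complex.ofReal_re,
      update_eq_self, sphDeriv, if_neg hK, if_neg him, map_smul, smul_eq_mul, stemPair,
      div_eq_inv_mul]

lemma dist_update_le {n : ℕ} {z z₀ : Fin n → ℂ} {h : Fin n} {w : ℂ} {R : ℝ} (hR : 0 ≤ R)
    (hz : dist z z₀ ≤ R) (hw : dist w (z₀ h) ≤ R) : dist (update z h w) z₀ ≤ R := by
  rw [dist_pi_le_iff hR] at hz ⊢
  intro i
  by_cases hi : i = h
  · subst hi; rwa [update_self]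
  · rw [update_of_ne hi]; exact hz i

/-- Where `β_h ≠ 0` the quotient is visibly continuous. At `β_h = 0` the Cauchy integral has an
integrand continuous jointly in `z` and the angle. -/
lemma IsHolomorphicIn.continuousAt_sphDeriv {n : ℕ} {D : Set (Fin n → ℂ)} {S : Set (Fin n)}
    {G : (Fin n → ℂ) → StemSpace n} (hG : IsHolomorphicIn D S G) (hD : IsOpen D)
    {h : Fin n} (hh : h ∈ S) {z₀ : Fin n → ℂ} (hz₀ : z₀ ∈ D) :
    ContinuousAt (sphDeriv h G) z₀ := by
  rw [continuousAt_pi]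
  intro K
  by_cases hK : h ∈ K
  · have : (fun z => sphDeriv h G z K) = fun _ => 0 := by
      funext z; rw [sphDeriv, if_pos hK]
    rw [this]
    exact continuousAt_const
  by_cases him : (z₀ h).im = 0
  · refine continuousAt_of_forall_dual fun c => ?_
    obtain ⟨ε, hε, hball⟩ := Metric.isOpen_iff.1 hD z₀ hz₀
    set R := ε / 2 with hR
    have hR0 : 0 < R := half_pos hε
    have hmem : ∀ z ∈ closedBall z₀ R, ∀ w ∈ closedBall (z₀ h) R, update z h w ∈ D := by
      intro z hz w hw
      apply hball
      exact mem_ball.2 ((dist_update_le hR0.le hz hw).trans_lt (half_lt_self hε))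
    -- The point `z` stays within `R / 2` of `z₀`, so the poles `z h` and its conjugate keep away
    -- from the circle of radius `R`.
    have hR2 : R / 2 < R := half_lt_self hR0
    have hzh : ∀ z ∈ closedBall z₀ (R / 2), z h ∈ ball (z₀ h) R := fun z hz =>
      mem_ball.2 (((dist_le_pi_dist z z₀ h).trans hz).trans_lt hR2)
    have hcont : ContinuousOn (fun z : Fin n → ℂ =>
        (symmCauchy (fun w => stemPair c G h K (update z h w)) (z₀ h) R (z h)).re)
        (closedBall z₀ (R / 2)) := by
      suffices hc : ContinuousOn (fun z : Fin n → ℂ => ∮ ζ in C(z₀ h, R),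
          ((ζ - z h) * (ζ - star (z h)))⁻¹ • stemPair c G h K (update z h ζ))
          (closedBall z₀ (R / 2)) by
        have h2 : ContinuousOn (fun z : Fin n → ℂ =>
            symmCauchy (fun w => stemPair c G h K (update z h w)) (z₀ h) R (z h))
            (closedBall z₀ (R / 2)) := 
          hc.const_smul (2 * Real.pi * Complex.I : ℂ)⁻¹
        exact Complex.continuous_re.comp_continuousOn h2
      rw [continuousOn_iff_continuous_domRestrict]
      simp only [circleIntegral]
      refine intervalIntegral.continuous_parametric_intervalIntegral_of_continuous' ?_ _ _
      simp only [uncurry_def, deriv_circleMap]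
      have hz1 : Continuous fun p : closedBall z₀ (R / 2) × ℝ => (p.1 : Fin n → ℂ) h :=
        (continuous_apply h).comp (continuous_subtype_val.comp continuous_fst)
      have hz2 : Continuous fun p : closedBall z₀ (R / 2) × ℝ => circleMap (z₀ h) R p.2 :=
        (continuous_circleMap _ _).comp continuous_snd
      have hne : ∀ (p : closedBall z₀ (R / 2) × ℝ), ∀ v ∈ ball (z₀ h) R,
          circleMap (z₀ h) R p.2 - v ≠ 0 := by
        intro p v hv h0
        rw [sub_eq_zero] at h0
        have := circleMap_mem_sphere (z₀ h) hR0.le p.2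
        rw [h0] at this
        exact (ne_of_lt hv) this
      refine Continuous.smul (((continuous_circleMap 0 R).comp continuous_snd).mul
        continuous_const) (Continuous.smul (Continuous.inv₀ ((hz2.sub hz1).mul
          (hz2.sub hz1.star)) ?_) ?_)
      · intro p
        exact mul_ne_zero (hne p _ (hzh _ p.1.2)) (hne p _ (star_mem_ball him (hzh _ p.1.2)))
      · refine (hG.continuousOn_stemPair hD h K c).comp_continuous
          ((continuous_subtype_val.comp continuous_fst).update h hz2) fun p => ?_
        exact hmem _ (closedBall_subset_closedBall hR2.le p.1.2) _
          (circleMap_mem_closedBall (z₀ h) hR0.le p.2)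
    refine ((hcont z₀ (mem_closedBall_self (half_pos hR0).le)).continuousAt
      (closedBall_mem_nhds z₀ (half_pos hR0))).congr ?_
    filter_upwards [closedBall_mem_nhds z₀ (half_pos hR0)] with z hz
    exact (hG.dual_sphDeriv hD hh hK c him (hzh z hz)
      (hmem z (closedBall_subset_closedBall hR2.le hz))).symm
  · have hne : ∀ᶠ z in 𝓝 z₀, (z h).im ≠ 0 :=
      (Complex.continuous_im.comp (continuous_apply h)).continuousAt.eventually_ne him
    have hc : ContinuousAt (fun z : Fin n → ℂ => (z h).im⁻¹ • G z (insert h K)) z₀ := by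
      have h1 : ContinuousAt (fun z : Fin n → ℂ => (z h).im) z₀ :=
        (Complex.continuous_im.comp (continuous_apply h)).continuousAt
      have h2 := h1.inv₀ him
      exact h2.smul (continuousAt_pi.1 (hG.continuousOn.continuousAt (hD.mem_nhds hz₀)) _)
    refine hc.congr ?_
    filter_upwards [hne] with z hz
    rw [sphDeriv, if_neg hK, if_neg hz]

lemma card_insert_inter_singleton {n : ℕ} {h h' : Fin n} (hne : h ≠ h') (K : Finset (Fin n)) :
    (insert h K ∩ {h'}).card = (K ∩ {h'}).card := by
  rw [Finset.insert_inter_of_notMem (by simpa using hne)]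

lemma conjAt_update {n : ℕ} {h h' : Fin n} (hne : h' ≠ h) (z : Fin n → ℂ) (w : ℂ) :
    conjAt h' (update z h w) = update (conjAt h' z) h w := by
  rw [conjAt, conjAt, update_of_ne hne, update_comm hne]

/-- Under conjugation of `z_h` the signs of `F_{K ∪ h}` and `β_h` cancel. Conjugation of another
coordinate leaves `β_h` alone and acts on `K` and `K ∪ {h}` with the same sign, which also passes
through the derivative at `β_h = 0`. -/
lemma IsHolomorphicIn.isStem_sphDeriv {n : ℕ} {D : Set (Fin n → ℂ)} {S : Set (Fin n)}
    {G : (Fin n → ℂ) → StemSpace n} (hG : IsHolomorphicIn D S G) (hD : IsOpen D)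
    {h : Fin n} (hh : h ∈ S) : IsStem D (sphDeriv h G) := by
  refine ⟨hG.isStem.1, fun z hz h' K => ?_⟩
  by_cases hK : h ∈ K
  · simp only [sphDeriv, if_pos hK, smul_zero]
  have hzc := hG.isStem.1 z hz h'
  rcases eq_or_ne h' h with rfl | hne
  · rw [Finset.inter_singleton_of_notMem hK, Finset.card_empty, pow_zero, one_smul]
    by_cases him : (z h').im = 0
    · have e : conjAt h' z = z := by
        have : star (z h') = z h' := by apply Complex.ext <;> simp [him]
        rw [conjAt, this, update_eq_self]
      rw [e]
    · have him' : (conjAt h' z h').im = -(z h').im := by simp [conjAt]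
      have him2 : (conjAt h' z h').im ≠ 0 := by rw [him']; exact neg_ne_zero.2 him
      have e : insert h' K ∩ {h'} = {h'} := by simp
      rw [sphDeriv, sphDeriv, if_neg hK, if_neg him2, if_neg hK, if_neg him, him',
        hG.isStem.2 z hz, e, Finset.card_singleton, pow_one, neg_one_smul, inv_neg, neg_smul_neg]
  · have hzh : conjAt h' z h = z h := by rw [conjAt, update_of_ne hne.symm]
    have hcard := card_insert_inter_singleton hne.symm K
    by_cases him : (z h).im = 0
    · have him2 : (conjAt h' z h).im = 0 := by rw [hzh, him]
      rw [sphDeriv, sphDeriv, if_neg hK, if_pos him2, if_neg hK, if_pos him]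
      refine (SeparatingDual.eq_iff_forall_dual_eq (R := ℝ)).2 fun c => ?_
      rw [map_smul, hG.dual_partialBeta hh hK c hz, hG.dual_partialBeta hh hK c hzc, hzh]
      have hev : (fun w => stemPair c G h K (update (conjAt h' z) h w)) =ᶠ[𝓝 (z h)]
          fun w => (((-1 : ℝ) ^ (K ∩ {h'}).card : ℝ) : ℂ) * stemPair c G h K (update z h w) := by
        have hU : {w | update z h w ∈ D} ∈ 𝓝 (z h) :=
          (isOpen_update_preimage hD z h).mem_nhds (by rwa [mem_ofPred_eq, update_eq_self])
        filter_upwards [hU] with w hw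
        rw [← conjAt_update hne, stemPair, stemPair, hG.isStem.2 _ hw, hG.isStem.2 _ hw, hcard,
          map_smul, map_smul]
        apply Complex.ext
        · rw [Complex.re_ofReal_mul, smul_eq_mul]
        · rw [Complex.im_ofReal_mul]; rfl
      rw [hev.deriv_eq, deriv_const_mul_field, Complex.re_ofReal_mul, smul_eq_mul]
    · have him2 : (conjAt h' z h).im ≠ 0 := by rwa [hzh]
      rw [sphDeriv, sphDeriv, if_neg hK, if_neg him2, if_neg hK, if_neg him, hzh,
        hG.isStem.2 z hz, hcard, smul_comm]

lemma IsHolomorphicIn.differentiableAt_sphDeriv_of_im_ne_zero {n : ℕ} {D : Set (Fin n → ℂ)}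
    {S : Set (Fin n)} {G : (Fin n → ℂ) → StemSpace n} (hG : IsHolomorphicIn D S G)
    {h h' : Fin n} (hh' : h' ∈ S) (hne : h' ≠ h) {K : Finset (Fin n)}
    (hK : h' ∉ K) (c : ℍ →L[ℝ] ℝ) {z : Fin n → ℂ} (hz : z ∈ D) (him : (z h).im ≠ 0) :
    DifferentiableAt ℂ (fun w => stemPair c (sphDeriv h G) h' K (update z h' w)) (z h') := by
  by_cases hhK : h ∈ K
  · have : (fun w => stemPair c (sphDeriv h G) h' K (update z h' w)) = fun _ => 0 := by
      funext w
      rw [stemPair, sphDeriv, sphDeriv, if_pos hhK, if_pos (Finset.mem_insert_of_mem hhK), map_zero]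
      rfl
    rw [this]
    exact differentiableAt_const _
  · have hhK' : h ∉ insert h' K := by simp [hne.symm, hhK]
    have hK' : h' ∉ insert h K := by simp [hne, hK]
    have : (fun w => stemPair c (sphDeriv h G) h' K (update z h' w)) =
        fun w => (((z h).im⁻¹ : ℝ) : ℂ) * stemPair c G h' (insert h K) (update z h' w) := by
      funext w
      have e : update z h' w h = z h := update_of_ne hne.symm _ _
      rw [stemPair, sphDeriv, sphDeriv, e, if_neg hhK, if_neg hhK', if_neg him, if_neg him,
        stemPair, Finset.insert_comm, map_smul, map_smul]
      apply Complex.ext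
      · rw [Complex.re_ofReal_mul, smul_eq_mul]
      · rw [Complex.im_ofReal_mul]; rfl
    rw [this]
    exact (hG.differentiableAt h' hh' _ hK' c z hz).const_mul _

/-- In a variable other than `x_h` the factor `β_h⁻¹` is constant, which settles `β_h ≠ 0`. At `β_h
= 0` the function is a locally uniform limit of its translates at height `ε > 0` in `z_h`, and such
limits of holomorphic functions are holomorphic. -/
theorem IsHolomorphicIn.sphDeriv {n : ℕ} {D : Set (Fin n → ℂ)} {S : Set (Fin n)}
    {G : (Fin n → ℂ) → StemSpace n} (hG : IsHolomorphicIn D S G) (hD : IsOpen D)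
    {h : Fin n} (hh : h ∈ S) : IsHolomorphicIn D (S \ {h}) (sphDeriv h G) := by
  have hcont : ContinuousOn (SliceSeveral.sphDeriv h G) D := fun z hz =>
    (hG.continuousAt_sphDeriv hD hh hz).continuousWithinAt
  refine ⟨hG.isStem_sphDeriv hD hh, hcont, ?_⟩
  rintro h' ⟨hh', hne⟩ K hK c z₀ hz₀
  rw [mem_singleton_iff] at hne
  by_cases him : (z₀ h).im = 0
  swap
  · exact hG.differentiableAt_sphDeriv_of_im_ne_zero hh' hne hK c hz₀ him
  obtain ⟨δ, hδ, hball⟩ := Metric.isOpen_iff.1 hD z₀ hz₀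
  set R := δ / 2 with hR
  have hR0 : 0 < R := half_pos hδ
  set p : ℝ → ℂ → Fin n → ℂ := fun ε w => update (update z₀ h (z₀ h + ε * Complex.I)) h' w with hp
  have hpD : ∀ ε ∈ Icc 0 R, ∀ w ∈ closedBall (z₀ h') R, p ε w ∈ D := by
    intro ε hε w hw
    refine hball (mem_ball.2 ((dist_update_le hR0.le ?_ hw).trans_lt (half_lt_self hδ)))
    refine dist_update_le hR0.le (by rw [dist_self]; exact hR0.le) ?_
    rw [dist_eq_norm, add_sub_cancel_left, norm_mul, Complex.norm_I, mul_one, Complex.norm_real,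
      Real.norm_eq_abs, abs_of_nonneg hε.1]
    exact hε.2
  have hpc : Continuous fun q : ℝ × ℂ => p q.1 q.2 := by
    have h1 : Continuous fun q : ℝ × ℂ => z₀ h + q.1 * Complex.I := by fun_prop
    exact ((continuous_const (y := z₀)).update h h1).update h' continuous_snd
  have hpair : ContinuousOn (stemPair c (SliceSeveral.sphDeriv h G) h' K) D := by
    intro z hz
    have hc : ∀ L, ContinuousAt (fun z => c (SliceSeveral.sphDeriv h G z L)) z := fun L =>
      c.continuous.continuousAt.comp (continuousAt_pi.1 (hcont.continuousAt (hD.mem_nhds hz)) L)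
    exact (continuousAt_mk (hc _) (hc _)).continuousWithinAt
  set Ψ : ℝ → ℂ → ℂ := fun ε w => stemPair c (SliceSeveral.sphDeriv h G) h' K (p ε w) with hΨ
  have hunif : UniformContinuousOn (↿Ψ) (Icc 0 R ×ˢ closedBall (z₀ h') R) :=
    (isCompact_Icc.prod (isCompact_closedBall _ _)).uniformContinuousOn_of_continuous
      (hpair.comp hpc.continuousOn fun q hq => hpD q.1 hq.1 q.2 hq.2)
  have hlim := (hunif.tendstoUniformlyOn (left_mem_Icc.2 hR0.le)).mono ball_subset_closedBall
  -- Uniform continuity needs the compact interval including `ε = 0`, whereas holomorphy is known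
  -- only for `ε > 0`.
  have hle : 𝓝[Ioc 0 R] (0 : ℝ) ≤ 𝓝[Icc 0 R] 0 := nhdsWithin_mono _ Ioc_subset_Icc_self
  have hlim2 : TendstoLocallyUniformlyOn Ψ (Ψ 0) (𝓝[Ioc 0 R] 0) (ball (z₀ h') R) :=
    TendstoUniformlyOn.tendstoLocallyUniformlyOn fun u hu => hle (hlim u hu)
  have hne' : (𝓝[Ioc 0 R] (0 : ℝ)).NeBot := by
    rw [nhdsWithin_Ioc_eq_nhdsGT hR0]; infer_instance
  have hdiff := hlim2.differentiableOn (by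
    filter_upwards [self_mem_nhdsWithin] with ε hε w hw
    have hpm := hpD ε ⟨hε.1.le, hε.2⟩ w (ball_subset_closedBall hw)
    have him' : (p ε w h).im ≠ 0 := by
      simp only [hp]
      rw [update_of_ne (Ne.symm hne), update_self]
      simpa [him] using hε.1.ne'
    have := hG.differentiableAt_sphDeriv_of_im_ne_zero hh' hne hK c hpm him'
    simp only [hp, update_idem, update_self] at this
    exact this.differentiableWithinAt) isOpen_ball
  have h0 : Ψ 0 = fun w => stemPair c (SliceSeveral.sphDeriv h G) h' K (update z₀ h' w) := by
    funext w
    simp only [hΨ, hp, Complex.ofReal_zero, zero_mul, add_zero, update_eq_self]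
  rw [h0] at hdiff
  exact hdiff.differentiableAt (ball_mem_nhds _ hR0)

/-! ### Iterated spherical derivatives -/

lemma firstVars_succ {n m : ℕ} (hm : m < n) :
    firstVars n (m + 1) = insert ⟨m, hm⟩ (firstVars n m) := by
  ext i
  simp only [firstVars, Finset.mem_filter, Finset.mem_univ, true_and, Finset.mem_insert,
    Fin.ext_iff]
  omega

lemma sort_insert_of_lt {n : ℕ} {h : Fin n} {H : Finset (Fin n)} (hH : ∀ i ∈ H, i < h) :
    (insert h H).sort = H.sort ++ [h] := by
  have hmem : h ∉ H := fun hh => lt_irrefl _ (hH h hh)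
  have hp : ((insert h H).sort).Perm (H.sort ++ [h]) := by
    rw [← Multiset.coe_eq_coe, Finset.sort_eq, ← Multiset.coe_add, Finset.sort_eq,
      Finset.insert_val_of_notMem hmem, Multiset.coe_singleton, add_comm, Multiset.singleton_add]
  refine hp.eq_of_pairwise' (Finset.pairwise_sort _ _) ?_
  rw [List.pairwise_append]
  refine ⟨Finset.pairwise_sort _ _, List.pairwise_singleton _ _, fun a ha b hb => ?_⟩
  rw [List.mem_singleton] at hb
  rw [hb]
  exact (hH a ((Finset.mem_sort _).1 ha)).le

lemma lt_of_mem_firstVars {n m : ℕ} (hm : m < n) : ∀ i ∈ firstVars n m, i < ⟨m, hm⟩ := by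
  intro i hi
  simpa [firstVars, Fin.lt_def] using hi

lemma iterSphDeriv_firstVars_zero {n : ℕ} (F : (Fin n → ℂ) → StemSpace n) :
    iterSphDeriv (firstVars n 0) F = F := by
  have : firstVars n 0 = ∅ := by simp [firstVars]
  rw [this, iterSphDeriv, Finset.sort_empty, List.foldl_nil]

lemma iterSphDeriv_firstVars_succ {n m : ℕ} (hm : m < n) (F : (Fin n → ℂ) → StemSpace n) :
    iterSphDeriv (firstVars n (m + 1)) F =
      sphDeriv ⟨m, hm⟩ (iterSphDeriv (firstVars n m) F) := by
  rw [iterSphDeriv, firstVars_succ hm, sort_insert_of_lt (lt_of_mem_firstVars hm),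
    List.foldl_append]
  rfl

lemma IsHolomorphicIn.iterSphDeriv {n : ℕ} {D : Set (Fin n → ℂ)}
    {F : (Fin n → ℂ) → StemSpace n} (hF : IsHolomorphicIn D univ F) (hD : IsOpen D) {m : ℕ}
    (hm : m ≤ n) : IsHolomorphicIn D {i | m ≤ i.val} (iterSphDeriv (firstVars n m) F) := by
  induction m with
  | zero =>
    rw [iterSphDeriv_firstVars_zero]
    simpa using hF
  | succ m ih =>
    rw [iterSphDeriv_firstVars_succ hm]
    have := (ih (Nat.le_of_succ_le hm)).sphDeriv hD (h := ⟨m, hm⟩) (le_refl m)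
    convert this using 1
    ext i
    simp only [mem_ofPred_eq, Set.mem_sdiff, mem_singleton_iff, Fin.ext_iff]
    omega

/-- A spherical derivative in `x_h` kills the components containing `h`, and later derivatives
preserve this. Hence the induced function no longer involves the units of the first `m` variables.
-/
lemma iterSphDeriv_firstVars_eq_zero {n : ℕ} {D : Set (Fin n → ℂ)}
    {F : (Fin n → ℂ) → StemSpace n} (hF : IsHolomorphicIn D univ F) (hD : IsOpen D) {m : ℕ}
    (hm : m ≤ n) {K : Finset (Fin n)} {h : Fin n} (hh : h ∈ K) (hhm : h.val < m)
    {z : Fin n → ℂ} (hz : z ∈ D) : SliceSeveral.iterSphDeriv (firstVars n m) F z K = 0 := by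
  induction m generalizing K z with
  | zero => exact absurd hhm (Nat.not_lt_zero _)
  | succ m ih =>
    rw [iterSphDeriv_firstVars_succ hm]
    by_cases hK : (⟨m, hm⟩ : Fin n) ∈ K
    · rw [SliceSeveral.sphDeriv, if_pos hK]
    · have hlt : h.val < m := by
        refine lt_of_le_of_ne (Nat.le_of_lt_succ hhm) ?_
        rintro rfl
        exact hK hh
      have hm' : m ≤ n := Nat.le_of_succ_le hm
      have hG := hF.iterSphDeriv hD hm'
      have hK' : h ∈ insert (⟨m, hm⟩ : Fin n) K := Finset.mem_insert_of_mem hh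
      by_cases him : (z ⟨m, hm⟩).im = 0
      · refine (SeparatingDual.eq_iff_forall_dual_eq (R := ℝ)).2 fun c => ?_
        rw [SliceSeveral.sphDeriv, if_neg hK, if_pos him,
          hG.dual_partialBeta (le_refl m) hK c hz, map_zero]
        have hev : (fun w => stemPair c (SliceSeveral.iterSphDeriv (firstVars n m) F) ⟨m, hm⟩ K
            (update z ⟨m, hm⟩ w)) =ᶠ[𝓝 (z ⟨m, hm⟩)] fun _ => 0 := by
          have hU : {w | update z ⟨m, hm⟩ w ∈ D} ∈ 𝓝 (z ⟨m, hm⟩) :=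
            (isOpen_update_preimage hD z _).mem_nhds (by rwa [mem_ofPred_eq, update_eq_self])
          filter_upwards [hU] with w hw
          rw [stemPair, ih hm' hh hlt hw, ih hm' hK' hlt hw, map_zero]
          rfl
        rw [hev.deriv_eq, deriv_const]
        rfl
      · rw [SliceSeveral.sphDeriv, if_neg hK, if_neg him, ih hm' hK' hlt hz, smul_zero]

lemma stemComponent_empty {n : ℕ} (H : Finset (Fin n)) (F : (Fin n → ℂ) → StemSpace n) :
    stemComponent H ∅ F = iterSphDeriv H F := by
  have : stemMul (stemMonomial ∅) F = F := by
    funext z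
    have h1 : ∀ K : Finset (Fin n), stemMonomial ∅ z K = if K = ∅ then 1 else 0 := fun K => by
      rw [stemMonomial, Finset.sort_empty, List.map_nil, List.foldr_nil, stemOne, Pi.single_apply]
    simp only [stemMul, h1]
    rw [Finset.sum_eq_single ∅]
    · funext K
      rw [Finset.sum_apply, Finset.sum_eq_single K]
      · have e : symmDiff (∅ : Finset (Fin n)) K = K := bot_symmDiff K
        simp [e]
      · intro L _ hL
        have e : symmDiff (∅ : Finset (Fin n)) L = L := bot_symmDiff L
        rw [e, Pi.single_eq_of_ne hL.symm]
      · simp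
    · intro K _ hK
      refine Finset.sum_eq_zero fun L _ => ?_
      rw [if_neg hK, zero_mul, smul_zero, Pi.single_zero]
    · simp
  rw [stemComponent, this]

/-! ### Induced functions -/

lemma complexCoord_apply {n : ℕ} (x : Fin n → ℍ) (h : Fin n) :
    complexCoord x h = halfPlane (x h) := rfl

lemma continuous_complexCoord {n : ℕ} : Continuous (complexCoord (n := n)) :=
  continuous_pi fun h => continuous_halfPlane.comp (continuous_apply h)

lemma norm_unitCoord {n : ℕ} (x : Fin n → ℍ) (h : Fin n) : ‖unitCoord x h‖ = 1 := by
  rw [unitCoord]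
  split_ifs with h0
  · rw [← sq_eq_sq₀ (norm_nonneg _) zero_le_one, norm_sq_eq_sum_sq]
    simp [quatI]
  · rw [norm_smul, norm_inv, norm_norm, inv_mul_cancel₀ (norm_ne_zero_iff.2 h0)]

lemma norm_orderedProd_unitCoord {n : ℕ} (x : Fin n → ℍ) (K : Finset (Fin n)) :
    ‖orderedProd (unitCoord x) K‖ = 1 := by
  rw [orderedProd]
  induction K.sort with
  | nil => simp
  | cons i l ih => rw [List.map_cons, List.prod_cons, norm_mul, norm_unitCoord, ih, one_mul]

lemma orderedProd_congr {n : ℕ} {q q' : Fin n → ℍ} {K : Finset (Fin n)}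
    (h : ∀ i ∈ K, q i = q' i) : orderedProd q K = orderedProd q' K := by
  rw [orderedProd, orderedProd]
  congr 1
  exact List.map_congr_left fun i hi => h i ((Finset.mem_sort _).1 hi)

lemma continuousAt_orderedProd {n : ℕ} {X : Type*} [TopologicalSpace X] {q : X → Fin n → ℍ}
    {K : Finset (Fin n)} {x : X} (h : ∀ i ∈ K, ContinuousAt (fun y => q y i) x) :
    ContinuousAt (fun y => orderedProd (q y) K) x := by
  simp only [orderedProd]
  have : ∀ l : List (Fin n), (∀ i ∈ l, ContinuousAt (fun y => q y i) x) →
      ContinuousAt (fun y => (l.map (q y)).prod) x := by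
    intro l
    induction l with
    | nil => intro _; simpa using continuousAt_const
    | cons i l ih =>
      intro hl
      simp only [List.map_cons, List.prod_cons]
      exact (hl i (by simp)).mul (ih fun j hj => hl j (by simp [hj]))
  exact this _ fun i hi => h i ((Finset.mem_sort _).1 hi)

lemma continuousAt_unitCoord {n : ℕ} {x : Fin n → ℍ} {h : Fin n} (hx : (x h).im ≠ 0) :
    ContinuousAt (fun y : Fin n → ℍ => unitCoord y h) x := by
  have him : ContinuousAt (fun y : Fin n → ℍ => (y h).im) x :=
    (Quaternion.continuous_im.comp (continuous_apply h)).continuousAt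
  have h1 : ContinuousAt (fun y : Fin n → ℍ => ‖(y h).im‖⁻¹ • (y h).im) x :=
    (him.norm.inv₀ (norm_ne_zero_iff.2 hx)).smul him
  refine h1.congr ?_
  filter_upwards [him.eventually_ne hx] with y hy
  rw [unitCoord, if_neg hy]

/-- The units jump at real coordinates, but there the corresponding components vanish, and the
products of units have norm 1. -/
lemma continuousOn_induced {n : ℕ} {D : Set (Fin n → ℂ)} (hD : IsOpen D)
    {G : (Fin n → ℂ) → StemSpace n} (hs : IsStem D G) (hG : ContinuousOn G D) :
    ContinuousOn (induced G) (circularization D) := by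
  intro x hx
  have hxD := hs.complexCoord_mem hx
  have hGx : ∀ K, ContinuousAt (fun y : Fin n → ℍ => G (complexCoord y) K) x := fun K =>
    ContinuousAt.comp (f := complexCoord) (g := fun z => G z K)
      (continuousAt_pi.1 (hG.continuousAt (hD.mem_nhds hxD)) K) continuous_complexCoord.continuousAt
  refine ContinuousAt.continuousWithinAt ?_
  unfold induced
  refine tendsto_finsetSum _ fun K _ => ?_
  by_cases hK : ∃ h ∈ K, (x h).im = 0
  · obtain ⟨h, hh, h0⟩ := hK
    have hz : G (complexCoord x) K = 0 := hs.eq_zero hxD hh (by simp [complexCoord, h0])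
    rw [hz, mul_zero]
    have h1 := hGx K
    rw [ContinuousAt, hz] at h1
    refine squeeze_zero_norm (fun y => ?_) (tendsto_zero_iff_norm_tendsto_zero.1 h1)
    rw [norm_mul, norm_orderedProd_unitCoord, one_mul]
  · push Not at hK
    exact (continuousAt_orderedProd fun i hi => continuousAt_unitCoord (hK i hi)).mul (hGx K)

lemma complexCoord_update {n : ℕ} (y : Fin n → ℍ) (h : Fin n) (q : ℍ) :
    complexCoord (update y h q) = update (complexCoord y) h (halfPlane q) := by
  funext i
  rw [complexCoord_apply]
  by_cases hi : i = h
  · subst hi; rw [update_self, update_self]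
  · rw [update_of_ne hi, update_of_ne hi, complexCoord_apply]

lemma orderedProd_insert_of_lt {n : ℕ} {q : Fin n → ℍ} {h : Fin n} {K : Finset (Fin n)}
    (hK : ∀ i ∈ K, h < i) : orderedProd q (insert h K) = q h * orderedProd q K := by
  rw [orderedProd, Finset.sort_insert _ (fun b hb => (hK b hb).le)
    (fun hh => lt_irrefl _ (hK h hh)), List.map_cons, List.prod_cons, orderedProd]

lemma sum_eq_sum_insert {n : ℕ} (h : Fin n) (φ : Finset (Fin n) → ℍ)
    (hφ : ∀ K, (∃ i ∈ K, i < h) → φ K = 0) :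
    ∑ K, φ K = ∑ K ∈ (Finset.univ.filter fun i => h < i).powerset, (φ K + φ (insert h K)) := by
  have hnot : h ∉ Finset.univ.filter fun i => h < i := by simp
  rw [Finset.sum_add_distrib, ← Finset.sum_powerset_insert hnot]
  symm
  refine Finset.sum_subset (Finset.subset_univ _) fun K _ hK => hφ K ?_
  rw [Finset.mem_powerset, Finset.not_subset] at hK
  obtain ⟨i, hi, hi'⟩ := hK
  simp only [Finset.mem_insert, Finset.mem_filter, Finset.mem_univ, true_and, not_or,
    not_lt] at hi'
  exact ⟨i, hi, lt_of_le_of_ne hi'.2 hi'.1⟩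

/-- **Mean value formula in the variable `x_h`**, for a function that depends on the imaginary
units of the variables `x_i`, `i ≥ h`, only. -/
theorem induced_mean_value {n : ℕ} {D : Set (Fin n → ℂ)} (hD : IsOpen D) {S : Set (Fin n)}
    {G : (Fin n → ℂ) → StemSpace n} (hG : IsHolomorphicIn D S G) {h : Fin n} (hh : h ∈ S)
    (hG0 : ∀ K, (∃ i ∈ K, i < h) → ∀ z ∈ D, G z K = 0)
    (hG0' : ∀ K, (∃ i ∈ K, i < h) → ∀ z ∈ D, sphDeriv h G z K = 0)
    {y : Fin n → ℍ} {r : ℝ} (hr : 0 ≤ r)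
    (hball : ∀ q ∈ closedBall (y h) r, update y h q ∈ circularization D) :
    induced G y = (∫ x : Sphere3, induced G (update y h (y h + r • (x : ℍ))) ∂sigma) +
      r • ∫ x : Sphere3, star (x : ℍ) *
        induced (sphDeriv h G) (update y h (y h + r • (x : ℍ))) ∂sigma := by
  set P := (Finset.univ.filter fun i : Fin n => h < i).powerset with hP
  have hPlt : ∀ K ∈ P, ∀ i ∈ K, h < i := fun K hK i hi => by
    simpa using Finset.mem_powerset.1 hK hi
  have hPnot : ∀ K ∈ P, h ∉ K := fun K hK hh => lt_irrefl _ (hPlt K hK h hh)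
  set u := unitCoord y with hu
  set ζ := complexCoord y with hζ
  set U : Set ℂ := {w | update ζ h w ∈ D} with hU
  have hUo : IsOpen U := isOpen_update_preimage hD ζ h
  have hG' := hG.sphDeriv hD hh
  set A : ℂ → ℍ := fun w => ∑ K ∈ P, orderedProd u K * G (update ζ h w) K with hA
  set B : ℂ → ℍ := fun w => ∑ K ∈ P, orderedProd u K * G (update ζ h w) (insert h K) with hB
  set T : ℂ → ℍ := fun w => ∑ K ∈ P, orderedProd u K * sphDeriv h G (update ζ h w) K with hT
  have hmemU : ∀ q ∈ closedBall (y h) r, halfPlane q ∈ U := fun q hq => by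
    have := hG.isStem.complexCoord_mem (hball q hq)
    rwa [complexCoord_update] at this
  have hup : Continuous fun w : ℂ => update ζ h w := continuous_const.update h continuous_id
  have hcont : ∀ {G : (Fin n → ℂ) → StemSpace n}, ContinuousOn G D → ∀ K,
      ContinuousOn (fun w => G (update ζ h w) K) U := fun hG K =>
    (continuous_apply K).comp_continuousOn (hG.comp hup.continuousOn fun w hw => hw)
  have hTB : ∀ w ∈ U, w.im • T w = B w := by
    intro w hw
    simp only [hT, hB, Finset.smul_sum]
    refine Finset.sum_congr rfl fun K hK => ?_
    rw [← mul_smul_comm]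
    congr 1
    by_cases him : w.im = 0
    · rw [him, zero_smul, hG.isStem.eq_zero hw (Finset.mem_insert_self h K)
        (by rw [update_self, him])]
    · rw [sphDeriv, if_neg (hPnot K hK), update_self, if_neg him, smul_inv_smul₀ him]
  have hrest : ∀ K ∈ P, ∀ q : ℍ, orderedProd (unitCoord (update y h q)) K = orderedProd u K := by
    intro K hK q
    refine orderedProd_congr fun i hi => ?_
    have hne : i ≠ h := (hPlt K hK i hi).ne'
    rw [hu, unitCoord, unitCoord, update_of_ne hne]
  have hGval : ∀ q ∈ closedBall (y h) r, induced G (update y h q) =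
      A (halfPlane q) + q.im * T (halfPlane q) := by
    intro q hq
    have hqU := hmemU q hq
    -- The unit of `x_h` precedes all the other surviving units and so can be factored out on the
    -- left. For real `q` both sides vanish, whatever unit was chosen.
    have e : q.im * T (halfPlane q) = unitCoord (update y h q) h * B (halfPlane q) := by
      rw [← hTB _ hqU, halfPlane_im, unitCoord, update_self]
      split_ifs with h0
      · rw [h0, norm_zero, zero_smul, zero_mul, mul_zero]
      · rw [smul_mul_assoc, mul_smul_comm, inv_smul_smul₀ (norm_ne_zero_iff.2 h0)]
    rw [e, induced, sum_eq_sum_insert h _ fun K hK => by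
      rw [hG0 K hK _ (hG.isStem.complexCoord_mem (hball q hq)), mul_zero]]
    simp only [hA, hB, Finset.mul_sum]
    rw [← Finset.sum_add_distrib]
    refine Finset.sum_congr rfl fun K hK => ?_
    rw [orderedProd_insert_of_lt (hPlt K hK), hrest K hK, complexCoord_update, mul_assoc]
  have hTval : ∀ q ∈ closedBall (y h) r,
      induced (sphDeriv h G) (update y h q) = T (halfPlane q) := by
    intro q hq
    rw [induced, sum_eq_sum_insert h _ fun K hK => by
      rw [hG0' K hK _ (hG.isStem.complexCoord_mem (hball q hq)), mul_zero]]
    simp only [hT]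
    refine Finset.sum_congr rfl fun K hK => ?_
    have h0 : sphDeriv h G (complexCoord (update y h q)) (insert h K) = 0 := by
      rw [sphDeriv, if_pos (Finset.mem_insert_self h K)]
    rw [h0, mul_zero, add_zero, hrest K hK, complexCoord_update]
  have hmain := slice_mean_value (A := A) (B := B) (S := T) hUo
    (fun w hw => update_mem_conj hG.isStem hw)
    (fun w hw => by
      simp only [hA]
      refine Finset.sum_congr rfl fun K hK => ?_
      rw [stem_update_star hG.isStem hw, Finset.inter_singleton_of_notMem (hPnot K hK)]
      simp)
    (fun w hw => by
      simp only [hB, ← Finset.sum_neg_distrib]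
      refine Finset.sum_congr rfl fun K hK => ?_
      rw [stem_update_star hG.isStem hw,
        Finset.inter_singleton_of_mem (Finset.mem_insert_self h K)]
      simp)
    -- The frozen product of units is absorbed into the functional `c`, leaving a finite sum of the
    -- holomorphic functions `stemPair`.
    (fun c => by
      have e : (fun w => (⟨c (A w), c (B w)⟩ : ℂ)) = fun w => ∑ K ∈ P,
          stemPair (c.comp (ContinuousLinearMap.mul ℝ ℍ (orderedProd u K))) G h K
            (update ζ h w) := by
        funext w
        apply Complex.ext
        · simp only [hA, map_sum, Complex.re_sum]
          rfl
        · simp only [hB, map_sum, Complex.im_sum]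
          rfl
      rw [e]
      exact DifferentiableOn.fun_sum fun K hK => hG.differentiableOn hh (hPnot K hK) _ ζ)
    (continuousOn_finsetSum _ fun K _ => continuousOn_const.mul (hcont hG.continuousOn K))
    (continuousOn_finsetSum _ fun K _ => continuousOn_const.mul (hcont hG'.continuousOn K))
    hTB hr hmemU
  have hyb : induced G y = A (halfPlane (y h)) + (y h).im * T (halfPlane (y h)) := by
    rw [← hGval _ (mem_closedBall_self hr), update_eq_self]
  rw [hyb, hmain]
  congr 1
  · exact integral_congr_ae (Eventually.of_forall fun x =>
      (hGval _ (smul_sphere_mem_closedBall hr _ x)).symm)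
  · congr 1
    refine integral_congr_ae (Eventually.of_forall fun x => ?_)
    simp only
    rw [hTval _ (smul_sphere_mem_closedBall hr _ x)]

/-! ### Integration over products of spheres -/

lemma sort_firstVars_succ_self (m : ℕ) :
    (firstVars (m + 1) m).sort = (List.finRange m).map Fin.castSucc := by
  have h1 := sort_insert_of_lt (lt_of_mem_firstVars (Nat.lt_succ_self m))
  have huniv : insert (⟨m, Nat.lt_succ_self m⟩ : Fin (m + 1)) (firstVars (m + 1) m) =
      Finset.univ := by
    rw [← firstVars_succ]
    ext i
    simpa [firstVars] using Nat.le_of_lt_succ i.isLt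
  rw [huniv, Fin.sort_univ, List.finRange_succ_last] at h1
  exact (List.append_inj_left' h1 rfl).symm

lemma sort_firstVars_self (m : ℕ) : (firstVars m m).sort = List.finRange m := by
  have : firstVars m m = Finset.univ := by ext i; simp [firstVars]
  rw [this, Fin.sort_univ]

lemma conjProd_snoc {m : ℕ} (lam : Fin m → Sphere3) (x : Sphere3) :
    conjProd m (Fin.snoc lam x : Fin (m + 1) → Sphere3) = conjProd m lam := by
  rw [conjProd, conjProd, orderedProd, orderedProd, sort_firstVars_succ_self, sort_firstVars_self,
    List.map_map]
  congr 1
  refine List.map_congr_left fun i _ => ?_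
  simp

/-- The new factor lands on the right of the product, next to the function, exactly where the
one-variable formula puts `λ̄`. -/
lemma conjProd_succ_snoc {m : ℕ} (lam : Fin m → Sphere3) (x : Sphere3) :
    conjProd (m + 1) (Fin.snoc lam x : Fin (m + 1) → Sphere3) =
      conjProd m lam * star (x : ℍ) := by
  rw [← conjProd_snoc lam x, conjProd, conjProd, orderedProd, orderedProd,
    firstVars_succ (Nat.lt_succ_self m),
    sort_insert_of_lt (lt_of_mem_firstVars (Nat.lt_succ_self m)), List.map_append,
    List.prod_append, List.map_singleton, List.prod_singleton]
  congr 3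
  exact Fin.snoc_last (α := fun _ => Sphere3) x lam

lemma shift_snoc {n m : ℕ} (hm : m < n) (a : Fin n → ℍ) (r : Fin n → ℝ) (lam : Fin m → Sphere3)
    (x : Sphere3) : shift a r (Fin.snoc lam x : Fin (m + 1) → Sphere3) =
      update (shift a r lam) ⟨m, hm⟩ (shift a r lam ⟨m, hm⟩ + r ⟨m, hm⟩ • (x : ℍ)) := by
  funext i
  by_cases hi : i = ⟨m, hm⟩
  · subst hi
    simp [shift, Fin.snoc]
  · rw [update_of_ne hi]
    have hne : i.val ≠ m := fun h => hi (Fin.ext h)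
    simp only [shift]
    by_cases h1 : i.val < m
    · simp [h1, Nat.lt_succ_of_lt h1, Fin.snoc]
    · have h2 : ¬ i.val < m + 1 := by omega
      rw [dif_neg h1, dif_neg h2]

/-- Fubini with the last sphere innermost, since it carries the variable to which the one-variable
formula is applied. -/
lemma integral_sigmaPow_succ {m : ℕ} {Φ : (Fin (m + 1) → Sphere3) → ℍ} (hΦ : Continuous Φ) :
    ∫ lam, Φ lam ∂sigmaPow (m + 1) =
      ∫ lam : Fin m → Sphere3, ∫ x : Sphere3, Φ (Fin.snoc lam x) ∂sigma ∂sigmaPow m := by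
  have e := (measurePreserving_piFinSuccAbove (fun _ : Fin (m + 1) => sigma) (Fin.last m)).symm
  have hint : Integrable Φ (sigmaPow (m + 1)) :=
    hΦ.integrable_of_hasCompactSupport (HasCompactSupport.of_compactSpace Φ)
  have h1 : ∫ p, Φ ((MeasurableEquiv.piFinSuccAbove (fun _ => Sphere3) (Fin.last m)).symm p)
      ∂(sigma.prod (sigmaPow m)) = ∫ lam, Φ lam ∂sigmaPow (m + 1) := e.integral_comp' Φ
  have h2 : Integrable (fun p =>
      Φ ((MeasurableEquiv.piFinSuccAbove (fun _ => Sphere3) (Fin.last m)).symm p))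
      (sigma.prod (sigmaPow m)) :=
    (e.integrable_comp_emb (MeasurableEquiv.measurableEmbedding _)).2 hint
  rw [← h1, integral_prod_symm _ h2]
  refine integral_congr_ae (Eventually.of_forall fun lam => ?_)
  refine integral_congr_ae (Eventually.of_forall fun x => ?_)
  change Φ (Fin.insertNth (α := fun _ => Sphere3) (Fin.last m) x lam) = Φ (Fin.snoc lam x)
  rw [Fin.insertNth_last']

lemma continuous_shift {n k : ℕ} (a : Fin n → ℍ) (r : Fin n → ℝ) :
    Continuous fun lam : Fin k → Sphere3 => shift a r lam := by
  refine continuous_pi fun i => continuous_const.add ?_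
  by_cases hi : i.val < k
  · simp only [hi, dif_pos]
    have h : Continuous fun lam : Fin k → Sphere3 => ((lam ⟨i.val, hi⟩ : Sphere3) : ℍ) :=
      continuous_subtype_val.comp (continuous_apply (⟨i.val, hi⟩ : Fin k))
    exact h.const_smul (r i)
  · simp only [hi, dif_neg, not_false_eq_true]
    exact continuous_const

lemma continuous_conjProd {k : ℕ} (j : ℕ) :
    Continuous fun lam : Fin k → Sphere3 => conjProd j lam := by
  refine continuous_list_prod _ fun i _ => ?_
  exact (continuous_subtype_val.comp (continuous_apply i)).star

lemma shift_mem_pi_closedBall {n k : ℕ} (a : Fin n → ℍ) {r : Fin n → ℝ} (hr : ∀ i, 0 ≤ r i)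
    (lam : Fin k → Sphere3) : shift a r lam ∈ univ.pi fun i => closedBall (a i) (r i) := by
  intro i _
  simp only [shift]
  split_ifs with hi
  · exact smul_sphere_mem_closedBall (hr i) _ _
  · rw [add_zero]
    exact mem_closedBall_self (hr i)

/-- The mean value formula in the variable `x_{m+1}`, integrated over the first `m` spheres. -/
lemma integral_conjProd_mul_induced {n : ℕ} {D : Set (Fin n → ℂ)} (hD : IsOpen D)
    {F : (Fin n → ℂ) → StemSpace n} (hF : IsHolomorphicIn D univ F) {a : Fin n → ℍ}
    {r : Fin n → ℝ} (hr : ∀ i, 0 ≤ r i)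
    (hball : (univ.pi fun i => closedBall (a i) (r i)) ⊆ circularization D) {m : ℕ} (hm : m < n) :
    ∫ lam : Fin m → Sphere3, conjProd m lam *
        induced (iterSphDeriv (firstVars n m) F) (shift a r lam) ∂sigmaPow m =
      (∫ lam : Fin (m + 1) → Sphere3, conjProd m lam *
        induced (iterSphDeriv (firstVars n m) F) (shift a r lam) ∂sigmaPow (m + 1)) +
      r ⟨m, hm⟩ • ∫ lam : Fin (m + 1) → Sphere3, conjProd (m + 1) lam *
        induced (iterSphDeriv (firstVars n (m + 1)) F) (shift a r lam) ∂sigmaPow (m + 1) := by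
  have hcont : ∀ j ≤ n, ∀ k, Continuous fun lam : Fin k → Sphere3 =>
      induced (iterSphDeriv (firstVars n j) F) (shift a r lam) := fun j hj k =>
    (continuousOn_induced hD (hF.iterSphDeriv hD hj).isStem
      (hF.iterSphDeriv hD hj).continuousOn).comp_continuous (continuous_shift a r)
      fun lam => hball (shift_mem_pi_closedBall a hr lam)
  have hc1 : Continuous fun lam : Fin (m + 1) → Sphere3 => conjProd m lam *
      induced (iterSphDeriv (firstVars n m) F) (shift a r lam) :=
    (continuous_conjProd m).mul (hcont m hm.le _)
  have hc2 : Continuous fun lam : Fin (m + 1) → Sphere3 => conjProd (m + 1) lam *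
      induced (iterSphDeriv (firstVars n (m + 1)) F) (shift a r lam) :=
    (continuous_conjProd (m + 1)).mul (hcont (m + 1) hm _)
  have hsnoc : ∀ lam : Fin m → Sphere3,
      Continuous fun x : Sphere3 => (Fin.snoc lam x : Fin (m + 1) → Sphere3) := fun lam =>
    (continuous_const (y := lam)).finSnoc continuous_id
  have hsnoc2 : Continuous fun p : (Fin m → Sphere3) × Sphere3 =>
      (Fin.snoc p.1 p.2 : Fin (m + 1) → Sphere3) := by
    refine continuous_pi fun i => Fin.lastCases ?_ (fun j => ?_) i
    · simpa only [Fin.snoc_last] using continuous_snd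
    · simp only [Fin.snoc_castSucc]
      exact (continuous_apply j).comp continuous_fst
  have hint : ∀ {g : Sphere3 → ℍ}, Continuous g → Integrable g sigma := fun {g} hg =>
    hg.integrable_of_hasCompactSupport (HasCompactSupport.of_compactSpace g)
  have hintm : ∀ {g : (Fin m → Sphere3) → ℍ}, Continuous g → Integrable g (sigmaPow m) :=
    fun {g} hg => hg.integrable_of_hasCompactSupport (HasCompactSupport.of_compactSpace g)
  rw [integral_sigmaPow_succ hc1, integral_sigmaPow_succ hc2]
  have hpc : ∀ {Φ : (Fin (m + 1) → Sphere3) → ℍ}, Continuous Φ →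
      Continuous fun lam : Fin m → Sphere3 => ∫ x : Sphere3, Φ (Fin.snoc lam x) ∂sigma := by
    intro Φ hΦ
    have := continuous_parametric_integral_of_continuous (μ := sigma) (s := (univ : Set Sphere3))
      (f := fun (lam : Fin m → Sphere3) (x : Sphere3) => Φ (Fin.snoc lam x))
      (hΦ.comp hsnoc2) isCompact_univ
    simpa only [Measure.restrict_univ] using this
  have hadd := integral_add (hintm (hpc hc1)) (hintm ((hpc hc2).const_smul (r ⟨m, hm⟩)))
  simp only [Pi.smul_apply] at hadd
  rw [← integral_smul, ← hadd]
  refine integral_congr_ae (Eventually.of_forall fun lam => ?_)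
  have hG := hF.iterSphDeriv hD hm.le
  have hstep := induced_mean_value hD hG (h := ⟨m, hm⟩) (le_refl m)
    (fun K ⟨i, hi, hlt⟩ z hz => iterSphDeriv_firstVars_eq_zero hF hD hm.le hi hlt hz)
    (fun K ⟨i, hi, hlt⟩ z hz => by
      rw [← iterSphDeriv_firstVars_succ hm]
      exact iterSphDeriv_firstVars_eq_zero hF hD hm hi (Nat.lt_succ_of_lt hlt) hz)
    (y := shift a r lam) (hr ⟨m, hm⟩) (fun q hq => by
      refine hball fun i _ => ?_
      -- Only the coordinates of index below `m` have been moved, so the ball in coordinate `m` is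
      -- still centred at that of `a`.
      have ha : shift a r lam ⟨m, hm⟩ = a ⟨m, hm⟩ := by simp [shift]
      by_cases hi : i = ⟨m, hm⟩
      · subst hi
        rw [ha] at hq
        rwa [update_self]
      · rw [update_of_ne hi]
        exact shift_mem_pi_closedBall a hr lam i (mem_univ i))
  simp only [← shift_snoc, ← iterSphDeriv_firstVars_succ hm] at hstep
  simp only [conjProd_snoc, conjProd_succ_snoc, mul_assoc]
  have hd1 : Continuous fun x : Sphere3 => induced (iterSphDeriv (firstVars n m) F)
      (shift a r (Fin.snoc lam x : Fin (m + 1) → Sphere3)) := (hcont m hm.le _).comp (hsnoc lam)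
  have hd2 : Continuous fun x : Sphere3 => star (x : ℍ) *
      induced (iterSphDeriv (firstVars n (m + 1)) F)
        (shift a r (Fin.snoc lam x : Fin (m + 1) → Sphere3)) :=
    continuous_subtype_val.star.mul ((hcont (m + 1) hm _).comp (hsnoc lam))
  rw [integral_quat_mul (hint hd1), integral_quat_mul (hint hd2), ← mul_smul_comm, ← mul_add,
    ← hstep]

lemma prod_firstVars_succ {n m : ℕ} (hm : m < n) (r : Fin n → ℝ) :
    ∏ i ∈ firstVars n (m + 1), r i = (∏ i ∈ firstVars n m, r i) * r ⟨m, hm⟩ := by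
  rw [firstVars_succ hm, Finset.prod_insert, mul_comm]
  intro h
  exact lt_irrefl _ (lt_of_mem_firstVars hm _ h)

end

end SliceSeveral

/-! ### Proof of the second mean value formula -/

open SliceSeveral in
theorem proposition4p11 (n : ℕ) (D : Set (Fin n → ℂ)) (hD : IsOpen D)
    (f : (Fin n → ℍ) → ℍ) (hf : IsSliceRegular D f)
    (a : Fin n → ℍ) (ha : a ∈ circularization D)
    (r : Fin n → ℝ) (hr : ∀ i, 0 ≤ r i)
    (hball : (Set.univ.pi fun i => Metric.closedBall (a i) (r i)) ⊆ circularization D)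
    (m : ℕ) (hm1 : 1 ≤ m) (hmn : m ≤ n) :
    (∀ j ∈ Finset.range m, MeasureTheory.Integrable
      (fun lam : Fin (j + 1) → Sphere3 =>
        conjProd j lam * component D (firstVars n j) ∅ f (shift a r lam))
      (sigmaPow (j + 1))) ∧
    MeasureTheory.Integrable
      (fun lam : Fin m → Sphere3 =>
        conjProd m lam * component D (firstVars n m) ∅ f (shift a r lam))
      (sigmaPow m) ∧
    f a =
      (∑ j ∈ Finset.range m, (∏ i ∈ firstVars n j, r i) •
        ∫ lam : Fin (j + 1) → Sphere3,
          conjProd j lam * component D (firstVars n j) ∅ f (shift a r lam) ∂sigmaPow (j + 1))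
      + (∏ i ∈ firstVars n m, r i) •
        ∫ lam : Fin m → Sphere3,
          conjProd m lam * component D (firstVars n m) ∅ f (shift a r lam) ∂sigmaPow m := by
  obtain ⟨F, hs, hhol, hfF⟩ := hf
  have hF : IsHolomorphicIn D Set.univ F := hhol.isHolomorphicIn hD hs
  have hmem : ∀ (k : ℕ) (lam : Fin k → Sphere3), shift a r lam ∈ circularization D :=
    fun k lam => hball (shift_mem_pi_closedBall a hr lam)
  have hcomp : ∀ (j k : ℕ) (lam : Fin k → Sphere3),
      component D (firstVars n j) ∅ f (shift a r lam) =
        induced (iterSphDeriv (firstVars n j) F) (shift a r lam) := fun j k lam => by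
    rw [component_eq_induced hD hs hfF _ _ (hmem k lam), stemComponent_empty]
  have hint : ∀ j ≤ n, ∀ k, MeasureTheory.Integrable (fun lam : Fin k → Sphere3 =>
      conjProd j lam * induced (iterSphDeriv (firstVars n j) F) (shift a r lam))
      (sigmaPow k) := fun j hj k => by
    have hG := hF.iterSphDeriv hD hj
    have hc : Continuous fun lam : Fin k → Sphere3 =>
        conjProd j lam * induced (iterSphDeriv (firstVars n j) F) (shift a r lam) :=
      (continuous_conjProd j).mul ((continuousOn_induced hD hG.isStem hG.continuousOn).comp_continuous
        (continuous_shift a r) (hmem k))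
    exact hc.integrable_of_hasCompactSupport (HasCompactSupport.of_compactSpace _)
  simp only [hcomp]
  refine ⟨fun j hj => hint j ((Finset.mem_range.1 hj).le.trans hmn) _, hint m hmn _, ?_⟩
  clear hm1
  -- The induction starts from `m = 0`, where the sum is empty and the remainder, an integral over a
  -- one-point space, equals `f a`.
  induction m with
  | zero =>
    have h0 : firstVars n 0 = ∅ := by simp [firstVars]
    have h1 : ∀ lam : Fin 0 → Sphere3, conjProd 0 lam = 1 := fun lam => by
      simp [conjProd, orderedProd, firstVars]
    have h2 : ∀ lam : Fin 0 → Sphere3, shift a r lam = a := fun lam => by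
      funext i; simp [shift]
    simp only [iterSphDeriv_firstVars_zero, h1, h2]
    simp [h0, hfF ha]
  | succ m ih =>
    have hm : m < n := hmn
    -- The remainder of the formula for `m` splits into the summand `j = m` and the remainder for `m
    -- + 1`.
    rw [ih hm.le, integral_conjProd_mul_induced hD hF hr hball hm, Finset.sum_range_succ,
      prod_firstVars_succ hm, smul_add, smul_smul, add_assoc]
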